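/- For integers $r>k\ge 0$ and $1<p\le\infty$, $1\le q\le\infty$, let $\mathring W^r_p(-1,1)$ be the set of functions $f$ on $[-1,1]$ having $r-1$ continuous derivatives with $f^{(r-1)}$ absolutely continuous, $f^{(r)}\in L_p(-1,1)$ and $f^{(j)}(\pm1)=0$ for $j=0,\dots,r-1$, and put $$\lambda(r,k,p,q)=\min\ \frac{\|f^{(r)}\|_{L_p[-1,1]}}{\|f^{(k)}\|_{L_q[-1,1]}},$$ the minimum being over nonzero $f\in\mathring W^r_p(-1,1)$; a function attaining it is called an extremal. For $x\in[-1,1]$ let $$A_{r,k}(x)=\max\{|f^{(k)}(x)| : f\in\mathring W^r_2(-1,1),\ \|f^{(r)}\|_{L_2(-1,1)}\le 1\}.$$ **Theorem 2.** Let $p=2$, $q=\infty$, let $k=4$ or $k=6$, and let $r>k$ be an integer. Then an extremal exists and every extremal is an even function. Moreover, the maxima defining $A_{r,k}$ are attained, $A_{r,k}$ attains its maximum over $[-1,1]$ at $x=0$, and $\lambda(r,k,2,\infty)=A_{r,k}(0)^{-1}$. Explicitly, $$\lambda(r,4,2,\infty)=\frac{2^{r-2}(r-3)!}{3}\sqrt{\frac{2r-9}{2}}\quad(r>4),\qquad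 \lambda(r,6,2,\infty)=\frac{2^{r-2}(r-4)!}{30}\sqrt{\frac{2r-13}{2}}\quad(r>6).$$ -/

import Mathlib

open MeasureTheory Set
open scoped ENNReal Nat

noncomputable section

namespace SymmetryOfExtremals

/-- The closed interval `[-1, 1]`. -/
abbrev J : Set ℝ := Icc (-1) 1

/-- The `j`-th derivative on `[-1, 1]` (one-sided at the endpoints; only the values of `f` on
`[-1, 1]` enter). -/
abbrev D (j : ℕ) (f : ℝ → ℝ) : ℝ → ℝ := iteratedDerivWithin j f J

/-- The norm of `L_p(-1, 1)`. -/
abbrev normLp (p : ℝ≥0∞) (g : ℝ → ℝ) : ℝ := (eLpNorm g p (volume.restrict J)).toReal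

/-- Membership in the Sobolev space `W̊_p^r(-1, 1)` for `r ≥ 1` (and `p > 1`): the function has
`r - 1` continuous derivatives on `[-1, 1]`, the last one is absolutely continuous, the `r`-th
derivative (which exists almost everywhere) lies in `L_p`, and the derivatives of orders
`0, …, r - 1` vanish at both endpoints. -/
structure MemW (r : ℕ) (p : ℝ≥0∞) (f : ℝ → ℝ) : Prop where
  contDiffOn : ContDiffOn ℝ ((r - 1 : ℕ)) f J
  absolutelyContinuous : AbsolutelyContinuousOnInterval (D (r - 1) f) (-1) 1
  memLp : MemLp (D r f) p (volume.restrict J)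
  left_eq_zero : ∀ j < r, D j f (-1) = 0
  right_eq_zero : ∀ j < r, D j f 1 = 0

/-- The functions over which the minimum is taken: nonzero elements of `W̊_p^r(-1, 1)`. -/
def Admissible (r : ℕ) (p : ℝ≥0∞) (f : ℝ → ℝ) : Prop :=
  MemW r p f ∧ ∃ x ∈ J, f x ≠ 0

/-- The functional `‖f^(r)‖_p / ‖f^(k)‖_q`. -/
def ratio (r k : ℕ) (p q : ℝ≥0∞) (f : ℝ → ℝ) : ℝ :=
  normLp p (D r f) / normLp q (D k f)

/-- `f` is an extremal: an admissible function at which the functional attains its minimum. -/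
def IsExtremal (r k : ℕ) (p q : ℝ≥0∞) (f : ℝ → ℝ) : Prop :=
  Admissible r p f ∧ ∀ g, Admissible r p g → ratio r k p q f ≤ ratio r k p q g

/-- The best constant `λ(r, k, p, q)`. -/
def bestConst (r k : ℕ) (p q : ℝ≥0∞) : ℝ :=
  sInf (ratio r k p q '' {f | Admissible r p f})

/-- The numbers `|f^(k)(x)|` for `f` in the unit ball of `W̊_2^r(-1, 1)`. -/
def pointValues (r k : ℕ) (x : ℝ) : Set ℝ :=
  {y | ∃ f, MemW r 2 f ∧ normLp 2 (D r f) ≤ 1 ∧ y = |D k f x|}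

/-- The function `A_{r,k}(x)`, the largest value of `|f^(k)(x)|` over the unit ball of
`W̊_2^r(-1, 1)`. -/
def A (r k : ℕ) (x : ℝ) : ℝ := sSup (pointValues r k x)

end SymmetryOfExtremals

end

/-!
Let `g` be the `r`-th derivative of `f ∈ W̊_2^r(-1, 1)` and `m = r - k - 1`. The boundary conditions say
that `g` is orthogonal to the polynomials of degree less than `r`, and `f^(k)` is the `(m + 1)`-fold
primitive of `g`, so `f^(k)(x) = ∫ (x - t)₊^m / m! g(t) dt`. Hence `A_{r,k}(x)²` is the squared
`L₂`-distance `sqDist m r x` from the truncated power to these polynomials, the maximum being attained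
at the residual `reprFun m r x` of the projection. Expanding in Legendre polynomials `Pₙ`,
`A² = (1 + x)^(2m+1) / ((2m+1) m!²) - ∑_{n < r} (n + 1/2) (I^(m+1) Pₙ)²`, where `I` is the primitive
vanishing at `-1`.

Everything rests on the shape of this function of `x`. Because `(2n+1) Pₙ = P'ₙ₊₁ - P'ₙ₋₁`, its
derivative telescopes to `-I^m P_{r-1} · I^m P_r` (`hasDerivAt_sqDist`). The relation
`x I^m Pₙ - I^m Pₙ₋₁ = (n+m+1) I^(m+1) Pₙ` then gives, with `n = r - 1`, `V = I^m Pₙ` and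
`v = I^(m+1) Pₙ`, the identity `A² = G - (k/2) v²` in which `G' = -x V²` (`sqDist_eq_majorant_sub`),
and the differential equation of `v` yields the closed form
`G = ((1 - x²) V² + β v²) / (2 (2m+1))`. For even `k ≥ 2` one has `v(0) = 0` and `V(0) ≠ 0`, so
`A(x)² ≤ G(x) < G(0) = A(0)²` for `x ≠ 0` (`sqDist_lt_sqDist_zero`), and `A(0)² = V(0)² / (2 (2m+1))` is
explicit, since `V(0)` is computed by recursion (`legendrePrim_even_zero`).

Consequently `‖f^(k)‖_∞ ≤ A(0) ‖f^(r)‖₂`, with equality for the function representing the evaluation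
at `0`, and equality for an extremal `f` can only come from the point `0`. There the reflection of `f`
is extremal for the same evaluation, as `k` is even, and the parallelogram law forces the two to
coincide (`MemW.even_of_D_sq_eq`).
-/

namespace SymmetryOfExtremals

/-! ### Legendre polynomials -/

open Polynomial in
/-- The Legendre polynomials on `[-1, 1]`, defined by Bonnet's three-term recursion. -/
noncomputable def legendre : ℕ → ℝ[X]
  | 0 => 1
  | 1 => X
  | n + 2 => C ((n : ℝ) + 2)⁻¹ *
      ((2 * (n : ℝ[X]) + 3) * X * legendre (n + 1) - ((n : ℝ[X]) + 1) * legendre n)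

open Polynomial in
theorem legendre_bonnet (n : ℕ) : ((n : ℝ[X]) + 2) * legendre (n + 2) =
    (2 * (n : ℝ[X]) + 3) * X * legendre (n + 1) - ((n : ℝ[X]) + 1) * legendre n := by
  have h : ((n : ℝ[X]) + 2) * C ((n : ℝ) + 2)⁻¹ = 1 := by
    have h2 : ((n : ℝ[X]) + 2) = C ((n : ℝ) + 2) := by
      simp only [map_add, map_natCast, map_ofNat]
    rw [h2, ← C_mul, mul_inv_cancel₀ (by positivity), C_1]
  rw [legendre, ← mul_assoc, h, one_mul]

open Polynomial in
/-- The two classical first-order relations `x P'ₙ - P'ₙ₋₁ = n Pₙ` and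
`(1 - x²) P'ₙ = n (Pₙ₋₁ - x Pₙ)`, whose inductive proofs need each other, and their companion
`P'ₙ₊₁ = x P'ₙ + (n + 1) Pₙ`. -/
theorem legendre_derivative_aux (n : ℕ) :
    X * derivative (legendre (n + 1)) - derivative (legendre n) =
        ((n : ℝ[X]) + 1) * legendre (n + 1) ∧
      (1 - X ^ 2) * derivative (legendre (n + 1)) =
        ((n : ℝ[X]) + 1) * (legendre n - X * legendre (n + 1)) ∧
      derivative (legendre (n + 2)) =
        X * derivative (legendre (n + 1)) + ((n : ℝ[X]) + 2) * legendre (n + 1) := by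
  -- the third relation follows from the first one by differentiating Bonnet's recursion
  have key : ∀ n : ℕ, X * derivative (legendre (n + 1)) - derivative (legendre n) =
      ((n : ℝ[X]) + 1) * legendre (n + 1) → derivative (legendre (n + 2)) =
        X * derivative (legendre (n + 1)) + ((n : ℝ[X]) + 2) * legendre (n + 1) := by
    intro n h
    have h0 : ((n : ℝ[X]) + 2) ≠ 0 := by
      have : ((n + 2 : ℕ) : ℝ[X]) ≠ 0 := Nat.cast_ne_zero.mpr (by omega)
      simpa using this
    have hb := congrArg derivative (legendre_bonnet n)
    simp only [derivative_mul, derivative_sub, derivative_add, derivative_natCast,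
      derivative_ofNat, derivative_one, derivative_X] at hb
    apply mul_left_cancel₀ h0
    linear_combination hb + ((n : ℝ[X]) + 1) * h
  induction n with
  | zero =>
    have h : X * derivative (legendre 1) - derivative (legendre 0) =
        (((0 : ℕ) : ℝ[X]) + 1) * legendre 1 := by simp [legendre]
    refine ⟨h, ?_, key 0 h⟩
    simp [legendre, pow_two]
  | succ n ih =>
    obtain ⟨h1, h2, h3⟩ := ih
    have hb := legendre_bonnet n
    have h : X * derivative (legendre (n + 2)) - derivative (legendre (n + 1)) =
        (((n + 1 : ℕ) : ℝ[X]) + 1) * legendre (n + 2) := by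
      push_cast
      linear_combination X * h3 - h2 - hb
    refine ⟨h, ?_, key (n + 1) h⟩
    push_cast
    linear_combination (1 - X ^ 2) * h3 + X * h2 + X * hb

open Polynomial in
theorem legendre_derivative_sub (n : ℕ) :
    derivative (legendre (n + 2)) - derivative (legendre n) =
      (2 * (n : ℝ[X]) + 3) * legendre (n + 1) := by
  obtain ⟨h1, -, h3⟩ := legendre_derivative_aux n
  linear_combination h3 + h1

open Polynomial in
theorem legendre_ode (n : ℕ) : derivative ((1 - X ^ 2) * derivative (legendre n)) =
    -((n : ℝ[X]) * ((n : ℝ[X]) + 1) * legendre n) := by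
  cases n with
  | zero => simp [legendre]
  | succ n =>
    obtain ⟨h1, h2, -⟩ := legendre_derivative_aux n
    rw [h2]
    simp only [derivative_mul, derivative_sub, derivative_add, derivative_natCast,
      derivative_one, derivative_X]
    push_cast
    linear_combination (-((n : ℝ[X]) + 1)) * h1

open Polynomial in
theorem natDegree_legendre_le (n : ℕ) : (legendre n).natDegree ≤ n := by
  induction n using Nat.twoStepInduction with
  | zero => simp [legendre]
  | one => simp [legendre]
  | more n h1 h2 =>
    have e1 : (2 * (n : ℝ[X]) + 3) = C (2 * (n : ℝ) + 3) := by
      simp only [map_add, map_mul, map_natCast, map_ofNat]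
    have e2 : ((n : ℝ[X]) + 1) = C ((n : ℝ) + 1) := by simp
    rw [legendre, e1, e2]
    refine (natDegree_C_mul_le _ _).trans ((natDegree_sub_le _ _).trans (max_le ?_ ?_))
    · rw [mul_assoc]
      refine (natDegree_C_mul_le _ _).trans (natDegree_mul_le.trans ?_)
      rw [natDegree_X]; omega
    · exact (natDegree_C_mul_le _ _).trans (by omega)

theorem legendre_eval_neg_one (n : ℕ) : (legendre n).eval (-1) = (-1) ^ n := by
  induction n using Nat.twoStepInduction with
  | zero => simp [legendre]
  | one => simp [legendre]
  | more n h1 h2 =>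
    simp only [legendre, Polynomial.eval_mul, Polynomial.eval_C, Polynomial.eval_sub,
      Polynomial.eval_add, Polynomial.eval_natCast, Polynomial.eval_ofNat, Polynomial.eval_X,
      Polynomial.eval_one, h1, h2]
    field_simp
    ring

open Polynomial in
theorem integral_eval_derivative (p : ℝ[X]) (a b : ℝ) :
    ∫ t in a..b, (derivative p).eval t = p.eval b - p.eval a :=
  intervalIntegral.integral_eq_sub_of_hasDerivAt (fun x _ => p.hasDerivAt x)
    ((derivative p).continuous.intervalIntegrable _ _)

open Polynomial in
theorem integral_legendre_mul_legendre_of_ne {n l : ℕ} (h : n ≠ l) :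
    ∫ t in (-1 : ℝ)..1, (legendre n).eval t * (legendre l).eval t = 0 := by
  have hd : derivative (((1 - X ^ 2) * derivative (legendre n)) * legendre l -
      ((1 - X ^ 2) * derivative (legendre l)) * legendre n) =
      C ((l : ℝ) * (l + 1) - n * (n + 1)) * (legendre n * legendre l) := by
    rw [derivative_sub, derivative_mul (g := legendre l), derivative_mul (g := legendre n),
      legendre_ode, legendre_ode]
    simp only [map_sub, map_mul, map_add, map_natCast, map_one]
    ring
  have hi := integral_eval_derivative (((1 - X ^ 2) * derivative (legendre n)) * legendre l -
      ((1 - X ^ 2) * derivative (legendre l)) * legendre n) (-1) 1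
  rw [hd] at hi
  simp only [eval_mul, eval_C, eval_sub, eval_one, eval_pow, eval_X,
    intervalIntegral.integral_const_mul] at hi
  have hne : (l : ℝ) * (l + 1) - n * (n + 1) ≠ 0 := by
    intro h0
    have h1 : ((l : ℝ) - n) * (l + n + 1) = 0 := by linear_combination h0
    rcases mul_eq_zero.mp h1 with h2 | h2
    · exact h (by exact_mod_cast (sub_eq_zero.mp h2).symm)
    · have : (0 : ℝ) < (l : ℝ) + n + 1 := by positivity
      exact this.ne' h2
  refine (mul_eq_zero.mp (hi.trans ?_)).resolve_left hne
  norm_num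

open Polynomial in
theorem integral_legendre_sq (n : ℕ) :
    ∫ t in (-1 : ℝ)..1, (legendre n).eval t * (legendre n).eval t = 2 / (2 * n + 1) := by
  induction n with
  | zero => norm_num [legendre]
  | succ n ih =>
    cases n with
    | zero => norm_num [legendre, ← pow_two]
    | succ n =>
      -- pair Bonnet's recursion with the two outer polynomials it contains
      have h1 : ((n : ℝ) + 2) * ∫ t in (-1 : ℝ)..1,
            (legendre (n + 2)).eval t * (legendre (n + 2)).eval t =
          (2 * n + 3) * ∫ t in (-1 : ℝ)..1,
            t * (legendre (n + 1)).eval t * (legendre (n + 2)).eval t := by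
        have h0 := integral_legendre_mul_legendre_of_ne (show n ≠ n + 2 by omega)
        have e : ∀ t : ℝ, (n + 2) * ((legendre (n + 2)).eval t * (legendre (n + 2)).eval t) =
            (2 * n + 3) * (t * (legendre (n + 1)).eval t * (legendre (n + 2)).eval t) -
            (n + 1) * ((legendre n).eval t * (legendre (n + 2)).eval t) := by
          intro t
          have := congrArg (eval t) (legendre_bonnet n)
          simp only [eval_mul, eval_sub, eval_add, eval_natCast, eval_ofNat, eval_X,
            eval_one] at this
          linear_combination (legendre (n + 2)).eval t * this
        rw [← intervalIntegral.integral_const_mul, ← intervalIntegral.integral_const_mul,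
          intervalIntegral.integral_congr (fun t _ => e t), intervalIntegral.integral_sub,
          intervalIntegral.integral_const_mul, intervalIntegral.integral_const_mul, h0]
        · simp
        · exact (Continuous.intervalIntegrable (by fun_prop) _ _)
        · exact (Continuous.intervalIntegrable (by fun_prop) _ _)
      have h2 : (2 * (n : ℝ) + 5) * ∫ t in (-1 : ℝ)..1,
            t * (legendre (n + 1)).eval t * (legendre (n + 2)).eval t =
          (n + 2) * ∫ t in (-1 : ℝ)..1,
            (legendre (n + 1)).eval t * (legendre (n + 1)).eval t := by
        have h0 := integral_legendre_mul_legendre_of_ne (show n + 1 ≠ n + 3 by omega)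
        have e : ∀ t : ℝ, (2 * n + 5) * (t * (legendre (n + 1)).eval t *
            (legendre (n + 2)).eval t) =
            (n + 2) * ((legendre (n + 1)).eval t * (legendre (n + 1)).eval t) +
            (n + 3) * ((legendre (n + 1)).eval t * (legendre (n + 3)).eval t) := by
          intro t
          have := congrArg (eval t) (legendre_bonnet (n + 1))
          simp only [eval_mul, eval_sub, eval_add, eval_natCast, eval_ofNat, eval_X,
            eval_one] at this
          push_cast at this
          linear_combination -(legendre (n + 1)).eval t * this
        rw [← intervalIntegral.integral_const_mul, ← intervalIntegral.integral_const_mul,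
          intervalIntegral.integral_congr (fun t _ => e t), intervalIntegral.integral_add,
          intervalIntegral.integral_const_mul, intervalIntegral.integral_const_mul, h0]
        · simp
        · exact (Continuous.intervalIntegrable (by fun_prop) _ _)
        · exact (Continuous.intervalIntegrable (by fun_prop) _ _)
      rw [ih] at h2
      push_cast at h2 ⊢
      have h3 : (2 * (n : ℝ) + 5) * ((n + 2) * ∫ t in (-1 : ℝ)..1,
            (legendre (n + 2)).eval t * (legendre (n + 2)).eval t) =
          (2 * n + 3) * ((n + 2) * (2 / (2 * (n + 1) + 1))) := by
        rw [h1, ← h2]; ring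
      have e1 : (2 * ((n : ℝ) + 1 + 1) + 1) ≠ 0 := by positivity
      have e2 : ((n : ℝ) + 2) ≠ 0 := by positivity
      rw [eq_div_iff e1]
      apply mul_left_cancel₀ e2
      have e4 : (2 * ((n : ℝ) + 1) + 1) ≠ 0 := by positivity
      have e3 : (2 * (n : ℝ) + 3) * ((n + 2) * (2 / (2 * (n + 1) + 1))) = (n + 2) * 2 := by
        field_simp
        ring
      rw [e3] at h3
      linear_combination h3

/-! ### Iterated primitives of Legendre polynomials -/

/-- The primitive of `g` that vanishes at `-1`. -/
noncomputable def primitive (g : ℝ → ℝ) (x : ℝ) : ℝ := ∫ t in (-1 : ℝ)..x, g t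

@[simp]
theorem primitive_neg_one (g : ℝ → ℝ) : primitive g (-1) = 0 := by simp [primitive]

theorem primitive_iterate_neg_one (g : ℝ → ℝ) (m : ℕ) : primitive^[m + 1] g (-1) = 0 := by
  rw [Function.iterate_succ_apply', primitive_neg_one]

theorem hasDerivAt_primitive {g : ℝ → ℝ} (hg : Continuous g) (x : ℝ) :
    HasDerivAt (primitive g) (g x) x :=
  intervalIntegral.integral_hasDerivAt_right (hg.intervalIntegrable _ _)
    (hg.stronglyMeasurableAtFilter _ _) hg.continuousAt

theorem continuous_primitive_of_continuous {g : ℝ → ℝ} (hg : Continuous g) :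
    Continuous (primitive g) :=
  continuous_iff_continuousAt.mpr fun x => (hasDerivAt_primitive hg x).continuousAt

theorem continuous_primitive_iterate_of_continuous {g : ℝ → ℝ} (hg : Continuous g) (m : ℕ) :
    Continuous (primitive^[m] g) := by
  induction m with
  | zero => exact hg
  | succ m ih =>
    rw [Function.iterate_succ_apply']
    exact continuous_primitive_of_continuous ih

theorem hasDerivAt_primitive_iterate {g : ℝ → ℝ} (hg : Continuous g) (m : ℕ) (x : ℝ) :
    HasDerivAt (primitive^[m + 1] g) (primitive^[m] g x) x := by
  rw [Function.iterate_succ_apply']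
  exact hasDerivAt_primitive (continuous_primitive_iterate_of_continuous hg m) x

/-- Two functions with the same derivative on `ℝ` that agree at `-1` are equal. -/
theorem eq_of_hasDerivAt_of_eq_neg_one {f g f' : ℝ → ℝ} (hf : ∀ x, HasDerivAt f (f' x) x)
    (hg : ∀ x, HasDerivAt g (f' x) x) (h : f (-1) = g (-1)) (x : ℝ) : f x = g x := by
  have hd : ∀ y, HasDerivAt (fun y => f y - g y) 0 y := fun y => by
    exact ((hf y).sub (hg y)).congr_deriv (sub_self _)
  have := is_const_of_deriv_eq_zero (fun y => (hd y).differentiableAt) (fun y => (hd y).deriv)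
    x (-1)
  simp only [h, sub_self] at this
  linarith

/-- The `m`-fold primitive of the `n`-th Legendre polynomial, with all primitives vanishing
at `-1`. -/
noncomputable def legendrePrim (m n : ℕ) : ℝ → ℝ := primitive^[m] fun t => (legendre n).eval t

theorem legendrePrim_zero (n : ℕ) (x : ℝ) : legendrePrim 0 n x = (legendre n).eval x := rfl

theorem continuous_legendrePrim (m n : ℕ) : Continuous (legendrePrim m n) :=
  continuous_primitive_iterate_of_continuous (legendre n).continuous m

theorem hasDerivAt_legendrePrim (m n : ℕ) (x : ℝ) :
    HasDerivAt (legendrePrim (m + 1) n) (legendrePrim m n x) x :=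
  hasDerivAt_primitive_iterate (legendre n).continuous m x

@[simp]
theorem legendrePrim_succ_neg_one (m n : ℕ) : legendrePrim (m + 1) n (-1) = 0 :=
  primitive_iterate_neg_one _ m

theorem legendrePrim_zero_right (m : ℕ) (x : ℝ) : legendrePrim m 0 x = (1 + x) ^ m / m ! := by
  induction m generalizing x with
  | zero => simp [legendrePrim_zero, legendre]
  | succ m ih =>
    refine eq_of_hasDerivAt_of_eq_neg_one (f' := legendrePrim m 0)
      (g := fun y => (1 + y) ^ (m + 1) / (m + 1)!) (hasDerivAt_legendrePrim m 0)
      (fun y => ?_) (by simp) x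
    rw [ih]
    have h := (((hasDerivAt_id y).const_add 1).pow (m + 1)).div_const ((m + 1)! : ℝ)
    refine h.congr_deriv ?_
    rw [Nat.factorial_succ]
    push_cast
    simp only [id]
    field_simp

theorem legendrePrim_succ_zero (m : ℕ) (x : ℝ) :
    legendrePrim (m + 1) 0 x = legendrePrim m 1 x + legendrePrim m 0 x := by
  induction m generalizing x with
  | zero =>
    rw [legendrePrim_zero_right]
    simp [legendrePrim_zero, legendre]
    ring
  | succ m ih =>
    refine eq_of_hasDerivAt_of_eq_neg_one
      (g := fun y => legendrePrim (m + 1) 1 y + legendrePrim (m + 1) 0 y)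
      (hasDerivAt_legendrePrim (m + 1) 0) (fun y => ?_)
      (by simp) x
    rw [ih]
    exact (hasDerivAt_legendrePrim m 1 y).add (hasDerivAt_legendrePrim m 0 y)

theorem legendrePrim_sub (m n : ℕ) (x : ℝ) :
    (2 * n + 3) * legendrePrim (m + 1) (n + 1) x =
      legendrePrim m (n + 2) x - legendrePrim m n x := by
  induction m generalizing x with
  | zero =>
    refine eq_of_hasDerivAt_of_eq_neg_one
      (f := fun y => (2 * n + 3) * legendrePrim 1 (n + 1) y)
      (g := fun y => legendrePrim 0 (n + 2) y - legendrePrim 0 n y)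
      (fun y => (hasDerivAt_legendrePrim 0 (n + 1) y).const_mul _) (fun y => ?_) ?_ x
    · have h := (((legendre (n + 2)).hasDerivAt y).sub ((legendre n).hasDerivAt y))
      refine h.congr_deriv ?_
      rw [← Polynomial.eval_sub, legendre_derivative_sub]
      simp [legendrePrim_zero]
    · simp [legendrePrim_zero, legendre_eval_neg_one, pow_add]
  | succ m ih =>
    refine eq_of_hasDerivAt_of_eq_neg_one
      (f := fun y => (2 * n + 3) * legendrePrim (m + 2) (n + 1) y)
      (g := fun y => legendrePrim (m + 1) (n + 2) y - legendrePrim (m + 1) n y)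
      (fun y => (hasDerivAt_legendrePrim (m + 1) (n + 1) y).const_mul _) (fun y => ?_)
      (by simp) x
    rw [ih]
    exact (hasDerivAt_legendrePrim m (n + 2) y).sub (hasDerivAt_legendrePrim m n y)

theorem mul_legendrePrim_sub (m n : ℕ) (x : ℝ) :
    x * legendrePrim m (n + 1) x - legendrePrim m n x =
      (n + m + 2) * legendrePrim (m + 1) (n + 1) x := by
  induction m generalizing x with
  | zero =>
    symm
    refine eq_of_hasDerivAt_of_eq_neg_one
      (f := fun y => (n + (0 : ℕ) + 2) * legendrePrim 1 (n + 1) y)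
      (g := fun y => y * legendrePrim 0 (n + 1) y - legendrePrim 0 n y)
      (fun y => (hasDerivAt_legendrePrim 0 (n + 1) y).const_mul _) (fun y => ?_) ?_ x
    · have h := ((hasDerivAt_id y).mul ((legendre (n + 1)).hasDerivAt y)).sub
        ((legendre n).hasDerivAt y)
      refine h.congr_deriv ?_
      have h1 := congrArg (Polynomial.eval y) (legendre_derivative_aux n).1
      simp only [Polynomial.eval_mul, Polynomial.eval_sub, Polynomial.eval_X,
        Polynomial.eval_add, Polynomial.eval_natCast, Polynomial.eval_one] at h1
      simp only [legendrePrim_zero, id]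
      push_cast
      linear_combination h1
    · simp [legendrePrim_zero, legendre_eval_neg_one, pow_add]
  | succ m ih =>
    symm
    refine eq_of_hasDerivAt_of_eq_neg_one
      (f := fun y => (n + (m + 1 : ℕ) + 2) * legendrePrim (m + 2) (n + 1) y)
      (g := fun y => y * legendrePrim (m + 1) (n + 1) y - legendrePrim (m + 1) n y)
      (fun y => (hasDerivAt_legendrePrim (m + 1) (n + 1) y).const_mul _) (fun y => ?_)
      (by simp) x
    have h := ((hasDerivAt_id y).mul (hasDerivAt_legendrePrim m (n + 1) y)).sub
      (hasDerivAt_legendrePrim m n y)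
    refine h.congr_deriv ?_
    simp only [id]
    push_cast
    linear_combination ih y

/-- The iterated primitives of `Pₙ` satisfy a Gegenbauer-type equation. -/
theorem legendrePrim_ode (m n : ℕ) (x : ℝ) : ∃ d, HasDerivAt (legendrePrim m n) d x ∧
    (1 - x ^ 2) * d = -(2 * m * x * legendrePrim m n x) -
      (n * (n + 1) - m * (m + 1)) * legendrePrim (m + 1) n x := by
  induction m generalizing x with
  | zero =>
    refine ⟨_, (legendre n).hasDerivAt x, ?_⟩
    refine (eq_of_hasDerivAt_of_eq_neg_one
      (f := fun y => (1 - y ^ 2) * (Polynomial.derivative (legendre n)).eval y)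
      (g := fun y => -((n : ℝ) * (n + 1) * legendrePrim 1 n y))
      (f' := fun y => -((n : ℝ) * (n + 1) * legendrePrim 0 n y))
      (fun y => ?_) (fun y => ?_) ?_ x).trans ?_
    · have h := ((1 - Polynomial.X ^ 2) * Polynomial.derivative (legendre n)).hasDerivAt y
      rw [legendre_ode] at h
      simpa [legendrePrim_zero] using h
    · exact ((hasDerivAt_legendrePrim 0 n y).const_mul _).neg
    · simp
    · simp
  | succ m ih =>
    refine ⟨_, hasDerivAt_legendrePrim m n x, ?_⟩
    have key := eq_of_hasDerivAt_of_eq_neg_one (f' := fun _ => 0)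
      (f := fun y => (1 - y ^ 2) * legendrePrim m n y +
        2 * (m + 1) * (y * legendrePrim (m + 1) n y) +
        (n * (n + 1) - (m + 1) * (m + 2)) * legendrePrim (m + 2) n y) (g := fun _ => 0)
      (fun y => ?_) (fun y => hasDerivAt_const y 0) (by simp) x
    · push_cast
      linear_combination key
    · obtain ⟨d, hd, he⟩ := ih y
      have h := ((((hasDerivAt_id y).pow 2).const_sub 1).mul hd).add
        ((((hasDerivAt_id y).mul (hasDerivAt_legendrePrim m n y)).const_mul
          (2 * ((m : ℝ) + 1)))) |>.add ((hasDerivAt_legendrePrim (m + 1) n y).const_mul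
          ((n : ℝ) * (n + 1) - (m + 1) * (m + 2)))
      refine h.congr_deriv ?_
      simp only [id]
      norm_num
      linear_combination he

theorem legendrePrim_zero_add_two (m n : ℕ) :
    legendrePrim m (n + 2) 0 = (n + 1 - m) * legendrePrim (m + 1) (n + 1) 0 := by
  have h1 := legendrePrim_sub m n 0
  have h2 := mul_legendrePrim_sub m n 0
  linear_combination -h1 - h2

theorem legendrePrim_diag_zero (m : ℕ) :
    legendrePrim m m 0 = (-1) ^ m / (2 ^ m * m !) := by
  induction m with
  | zero => simp [legendrePrim_zero, legendre]
  | succ m ih =>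
    have h := mul_legendrePrim_sub m m 0
    rw [ih] at h
    have : ((m : ℝ) + m + 2) ≠ 0 := by positivity
    apply mul_left_cancel₀ this
    rw [← h, Nat.factorial_succ]
    push_cast
    field_simp
    ring

theorem legendrePrim_even_zero (m j : ℕ) : legendrePrim m (m + 2 * j) 0 =
    (∏ i ∈ Finset.range j, (2 * i + 1 : ℝ)) * ((-1) ^ (m + j) / (2 ^ (m + j) * (m + j)!)) := by
  induction j generalizing m with
  | zero => simpa using legendrePrim_diag_zero m
  | succ j ih =>
    have h := legendrePrim_zero_add_two m (m + 2 * j)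
    rw [show m + 2 * j + 1 = m + 1 + 2 * j by ring, ih (m + 1)] at h
    rw [show m + 2 * (j + 1) = m + 2 * j + 2 by ring, h, Finset.prod_range_succ,
      show m + 1 + j = m + (j + 1) by ring]
    push_cast
    ring

theorem legendrePrim_odd_zero (m j : ℕ) : legendrePrim m (m + 2 * j + 1) 0 = 0 := by
  induction j generalizing m with
  | zero =>
    cases m with
    | zero => simp [legendrePrim_zero, legendre]
    | succ m => simpa using legendrePrim_zero_add_two (m + 1) m
  | succ j ih =>
    have h := legendrePrim_zero_add_two m (m + 2 * j + 1)
    rw [show m + 2 * j + 1 + 1 = m + 1 + 2 * j + 1 by ring, ih (m + 1), mul_zero] at h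
    exact h

/-! ### The squared distance as a function of the point -/

/-- The square of the `L₂(-1, 1)`-distance from `t ↦ (x - t)₊^m / m!` to the polynomials of degree
less than `r`, written through the Legendre coefficients of that function. -/
noncomputable def sqDist (m r : ℕ) (x : ℝ) : ℝ :=
  (1 + x) ^ (2 * m + 1) / ((2 * m + 1) * (m ! : ℝ) ^ 2) -
    ∑ n ∈ Finset.range r, ((n : ℝ) + 1 / 2) * legendrePrim (m + 1) n x ^ 2

theorem sqDist_succ (m r : ℕ) (x : ℝ) : sqDist m (r + 1) x =
    sqDist m r x - ((r : ℝ) + 1 / 2) * legendrePrim (m + 1) r x ^ 2 := by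
  rw [sqDist, Finset.sum_range_succ, sqDist]
  ring

theorem sqDist_neg_one (m r : ℕ) : sqDist m r (-1) = 0 := by
  simp [sqDist]

/-- A Christoffel–Darboux type formula: the sum telescopes after differentiation. -/
theorem hasDerivAt_sqDist (m r : ℕ) (x : ℝ) : HasDerivAt (sqDist m (r + 1))
    (-(legendrePrim m r x * legendrePrim m (r + 1) x)) x := by
  induction r with
  | zero =>
    have h0 : HasDerivAt (sqDist m 0) (legendrePrim m 0 x ^ 2) x := by
      have h : HasDerivAt (fun x : ℝ => (1 + x) ^ (2 * m + 1) / ((2 * m + 1) * (m ! : ℝ) ^ 2))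
          (legendrePrim m 0 x ^ 2) x := by
        refine ((((hasDerivAt_id x).const_add 1).pow (2 * m + 1)).div_const _).congr_deriv ?_
        rw [legendrePrim_zero_right]
        push_cast
        simp only [id]
        field_simp
        ring
      refine h.congr_of_eventuallyEq (Filter.Eventually.of_forall fun y => ?_)
      simp [sqDist]
    have h := h0.sub (((hasDerivAt_legendrePrim m 0 x).pow 2).const_mul (((0 : ℕ) : ℝ) + 1 / 2))
    refine (h.congr_of_eventuallyEq (Filter.Eventually.of_forall (sqDist_succ m 0))).congr_deriv ?_
    have := legendrePrim_succ_zero m x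
    simp only [Nat.cast_zero, Nat.cast_ofNat, Nat.add_one_sub_one, pow_one, zero_add]
    linear_combination (-legendrePrim m 0 x) * this
  | succ r ih =>
    have h := ih.sub (((hasDerivAt_legendrePrim m (r + 1) x).pow 2).const_mul
      (((r + 1 : ℕ) : ℝ) + 1 / 2))
    refine (h.congr_of_eventuallyEq
      (Filter.Eventually.of_forall (sqDist_succ m (r + 1)))).congr_deriv ?_
    have := legendrePrim_sub m r x
    push_cast
    simp only [pow_one]
    linear_combination (-legendrePrim m (r + 1) x) * this

/-- The comparison function: for `m ≤ n` it dominates `sqDist m (n + 1)`, it agrees with the latter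
at `0` when `n - m` is even and positive, and it is monotone on either side of `0`. -/
noncomputable def majorant (m n : ℕ) (x : ℝ) : ℝ :=
  ((1 - x ^ 2) * legendrePrim m n x ^ 2 +
    (n * (n + 1) - m * (m + 1)) * legendrePrim (m + 1) n x ^ 2) / (2 * (2 * m + 1))

theorem hasDerivAt_majorant (m n : ℕ) (x : ℝ) :
    HasDerivAt (majorant m n) (-(x * legendrePrim m n x ^ 2)) x := by
  obtain ⟨d, hd, he⟩ := legendrePrim_ode m n x
  have h := (((((hasDerivAt_id x).pow 2).const_sub 1).mul (hd.pow 2)).add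
    (((hasDerivAt_legendrePrim m n x).pow 2).const_mul
      ((n : ℝ) * (n + 1) - m * (m + 1)))).div_const (2 * (2 * (m : ℝ) + 1))
  refine h.congr_deriv ?_
  have : (2 * (2 * (m : ℝ) + 1)) ≠ 0 := by positivity
  rw [div_eq_iff this]
  simp only [id, Nat.cast_ofNat, Nat.add_one_sub_one, pow_one]
  norm_num
  linear_combination 2 * legendrePrim m n x * he

/-- The relation `x P - P₋ = …` turns the Christoffel–Darboux derivative `-P₋ P` of `sqDist` into
`-x P²` plus an exact derivative. -/
theorem sqDist_eq_majorant_sub (m n : ℕ) (x : ℝ) : sqDist m (n + 2) x =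
    majorant m (n + 1) x - ((n : ℝ) + 1 - m) / 2 * legendrePrim (m + 1) (n + 1) x ^ 2 := by
  have h := eq_of_hasDerivAt_of_eq_neg_one
    (f := fun y => sqDist m (n + 1) y -
      ((n : ℝ) + m + 2) / 2 * legendrePrim (m + 1) (n + 1) y ^ 2)
    (fun y => ?_) (hasDerivAt_majorant m (n + 1)) ?_ x
  · rw [← h, sqDist_succ]
    push_cast
    ring
  · have h := (hasDerivAt_sqDist m n y).sub
      (((hasDerivAt_legendrePrim m (n + 1) y).pow 2).const_mul (((n : ℝ) + m + 2) / 2))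
    refine h.congr_deriv ?_
    simp only [Nat.cast_ofNat, Nat.add_one_sub_one, pow_one]
    linear_combination legendrePrim m (n + 1) y * mul_legendrePrim_sub m n y
  · simp [sqDist_neg_one, majorant]

/-- If `G' = -x W` with `W ≥ 0` continuous and `W 0 > 0`, then `G` has a strict maximum at `0`. -/
theorem lt_apply_zero_of_hasDerivAt_neg_mul {G W : ℝ → ℝ} (hW : Continuous W) (hW0 : ∀ x, 0 ≤ W x)
    (hpos : 0 < W 0) (hG : ∀ x, HasDerivAt G (-(x * W x)) x) {x : ℝ} (hx : x ≠ 0) :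
    G x < G 0 := by
  -- it suffices to treat `x > 0`, because `y ↦ G (-y)` satisfies the same hypotheses
  wlog hx0 : 0 < x generalizing G W x
  · have h := this (G := fun y => G (-y)) (W := fun y => W (-y)) (by fun_prop)
      (fun y => hW0 _) (by simpa using hpos) (fun y => ?_) (neg_ne_zero.mpr hx)
      (by have := lt_of_le_of_ne (not_lt.mp hx0) hx; linarith)
    · simpa using h
    · have h := (hG (-y)).scomp y (hasDerivAt_neg y)
      refine h.congr_deriv ?_
      simp
  have hanti : AntitoneOn G (Icc 0 x) := by
    refine antitoneOn_of_deriv_nonpos (convex_Icc 0 x)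
      (fun y _ => (hG y).continuousAt.continuousWithinAt)
      (fun y _ => (hG y).differentiableAt.differentiableWithinAt) (fun y hy => ?_)
    rw [interior_Icc] at hy
    rw [(hG y).deriv]
    have := mul_nonneg hy.1.le (hW0 y)
    linarith
  refine lt_of_le_of_ne (hanti (left_mem_Icc.mpr hx0.le) (right_mem_Icc.mpr hx0.le) hx0.le)
    fun heq => ?_
  -- otherwise `G` is constant on `[0, x]`, so `W` vanishes on `(0, x)` and hence at `0`
  have hconst : ∀ y ∈ Icc 0 x, G y = G 0 := fun y hy =>
    le_antisymm (hanti (left_mem_Icc.mpr hx0.le) hy hy.1)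
      (heq ▸ hanti hy (right_mem_Icc.mpr hx0.le) hy.2)
  have hWz : ∀ y ∈ Ioo 0 x, W y = 0 := by
    intro y hy
    have h1 : HasDerivAt G 0 y := (hasDerivAt_const y (G 0)).congr_of_eventuallyEq <| by
      filter_upwards [Ioo_mem_nhds hy.1 hy.2] with z hz using hconst z ⟨hz.1.le, hz.2.le⟩
    have h2 := (hG y).unique h1
    exact (mul_eq_zero.mp (neg_eq_zero.mp h2)).resolve_left hy.1.ne'
  have hcl : Icc 0 x ⊆ {y | W y = 0} := by
    rw [← closure_Ioo hx0.ne]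
    exact closure_minimal hWz (isClosed_eq hW continuous_const)
  exact hpos.ne' (hcl (left_mem_Icc.mpr hx0.le))

theorem sqDist_even_zero (m j : ℕ) : sqDist m (m + 2 * (j + 1) + 1) 0 =
    legendrePrim m (m + 2 * (j + 1)) 0 ^ 2 / (2 * (2 * m + 1)) := by
  have h := sqDist_eq_majorant_sub m (m + 2 * j + 1) 0
  rw [majorant, show m + 2 * j + 1 + 1 = m + 1 + 2 * j + 1 by ring, legendrePrim_odd_zero] at h
  rw [show m + 2 * (j + 1) + 1 = m + 2 * j + 1 + 2 by ring, h,
    show m + 1 + 2 * j + 1 = m + 2 * (j + 1) by ring]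
  simp

theorem sqDist_even_zero_pos (m j : ℕ) : 0 < sqDist m (m + 2 * (j + 1) + 1) 0 := by
  rw [sqDist_even_zero, legendrePrim_even_zero]
  have : (∏ i ∈ Finset.range (j + 1), (2 * i + 1 : ℝ)) ≠ 0 :=
    Finset.prod_ne_zero_iff.mpr fun i _ => by positivity
  have h2 : (-1 : ℝ) ^ (m + (j + 1)) ≠ 0 := pow_ne_zero _ (by norm_num)
  positivity

theorem sqDist_lt_sqDist_zero (m j : ℕ) {x : ℝ} (hx : x ≠ 0) :
    sqDist m (m + 2 * (j + 1) + 1) x < sqDist m (m + 2 * (j + 1) + 1) 0 := by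
  have hp := sqDist_even_zero_pos m j
  have hx' := sqDist_eq_majorant_sub m (m + 2 * j + 1) x
  have h0 := sqDist_eq_majorant_sub m (m + 2 * j + 1) 0
  rw [show m + 2 * j + 1 + 1 = m + 2 * (j + 1) by ring] at hx' h0
  have hv : legendrePrim (m + 1) (m + 2 * (j + 1)) 0 = 0 := by
    have := legendrePrim_odd_zero (m + 1) j
    rwa [show m + 1 + 2 * j + 1 = m + 2 * (j + 1) by ring] at this
  have hlt : majorant m (m + 2 * (j + 1)) x < majorant m (m + 2 * (j + 1)) 0 := by
    refine lt_apply_zero_of_hasDerivAt_neg_mul ((continuous_legendrePrim m _).pow 2)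
      (fun y => sq_nonneg _) ?_ (hasDerivAt_majorant m _) hx
    rw [sqDist_even_zero] at hp
    rcases (sq_nonneg (legendrePrim m (m + 2 * (j + 1)) 0)).lt_or_eq with h | h
    · exact h
    · rw [← h, zero_div] at hp
      exact absurd hp (lt_irrefl _)
  rw [show m + 2 * (j + 1) + 1 = m + 2 * j + 1 + 2 by ring, hx', h0, hv]
  have : 0 ≤ (((m + 2 * j + 1 : ℕ) : ℝ) + 1 - m) / 2 *
      legendrePrim (m + 1) (m + 2 * (j + 1)) x ^ 2 := by
    refine mul_nonneg ?_ (sq_nonneg _)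
    push_cast
    have : (0 : ℝ) ≤ j := Nat.cast_nonneg j
    linarith
  linarith

/-! ### Iterated primitives of locally integrable functions -/

theorem intervalIntegrable_of_locallyIntegrable {g : ℝ → ℝ} (hg : LocallyIntegrable g volume)
    (a b : ℝ) : IntervalIntegrable g volume a b :=
  (hg.integrableOn_isCompact isCompact_uIcc).intervalIntegrable

theorem continuous_primitive {g : ℝ → ℝ} (hg : LocallyIntegrable g volume) :
    Continuous (primitive g) :=
  intervalIntegral.continuous_primitive (intervalIntegrable_of_locallyIntegrable hg) _

theorem continuous_primitive_iterate {g : ℝ → ℝ} (hg : LocallyIntegrable g volume) (m : ℕ) :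
    Continuous (primitive^[m + 1] g) := by
  rw [Function.iterate_succ_apply]
  exact continuous_primitive_iterate_of_continuous (continuous_primitive hg) m

theorem primitive_congr {g h : ℝ → ℝ} {x : ℝ} (hx : x ∈ J) (hgh : EqOn g h J) :
    primitive g x = primitive h x := by
  refine intervalIntegral.integral_congr fun t ht => hgh ?_
  rw [uIcc_of_le hx.1] at ht
  exact ⟨ht.1, ht.2.trans hx.2⟩

theorem primitive_iterate_const_mul (c : ℝ) (g : ℝ → ℝ) (m : ℕ) (x : ℝ) :
    primitive^[m] (fun t => c * g t) x = c * primitive^[m] g x := by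
  induction m generalizing x with
  | zero => rfl
  | succ m ih =>
    rw [Function.iterate_succ_apply', Function.iterate_succ_apply', primitive, primitive,
      ← intervalIntegral.integral_const_mul]
    exact intervalIntegral.integral_congr fun t _ => ih t

theorem integral_mul_eq_sub_integral_deriv_mul_primitive {g u u' : ℝ → ℝ}
    (hg : LocallyIntegrable g volume) (hu : ∀ t, HasDerivAt u (u' t) t) (hu' : Continuous u')
    (x : ℝ) : ∫ t in (-1 : ℝ)..x, u t * g t =
      u x * primitive g x - ∫ t in (-1 : ℝ)..x, u' t * primitive g t := by
  have hdu : deriv u = u' := funext fun t => (hu t).deriv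
  have hC : ContDiff ℝ 1 u :=
    contDiff_one_iff_deriv.mpr ⟨fun t => (hu t).differentiableAt, hdu ▸ hu'⟩
  have hga : AbsolutelyContinuousOnInterval (primitive g) (-1) x :=
    (intervalIntegrable_of_locallyIntegrable hg
      (-1) x).absolutelyContinuousOnInterval_intervalIntegral left_mem_uIcc
  have h := hC.contDiffOn.absolutelyContinuousOnInterval.integral_mul_deriv_eq_deriv_mul hga
  rw [primitive_neg_one, mul_zero, sub_zero, hdu] at h
  rw [← h]
  refine intervalIntegral.integral_congr_ae ?_
  filter_upwards [LocallyIntegrable.ae_hasDerivAt_integral hg] with t ht _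
  have h1 : HasDerivAt (primitive g) (g t) t := ht (-1)
  rw [h1.deriv]

/-- Cauchy's formula for iterated primitives. -/
theorem primitive_iterate_eq_integral {g : ℝ → ℝ} (hg : LocallyIntegrable g volume) (m : ℕ)
    (x : ℝ) : primitive^[m + 1] g x = ∫ t in (-1 : ℝ)..x, (x - t) ^ m / m ! * g t := by
  induction m generalizing g with
  | zero => simp [primitive]
  | succ m ih =>
    have hu : ∀ t, HasDerivAt (fun t => (x - t) ^ (m + 1) / (m + 1)!) (-((x - t) ^ m / m !)) t := by
      intro t
      refine ((((hasDerivAt_id t).const_sub x).pow (m + 1)).div_const _).congr_deriv ?_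
      rw [Nat.factorial_succ]
      push_cast
      simp only [id]
      field_simp
    rw [Function.iterate_succ_apply, ih (continuous_primitive hg).locallyIntegrable,
      integral_mul_eq_sub_integral_deriv_mul_primitive hg hu (by fun_prop)]
    simp

/-- `g` is the `r`-th derivative of an element of `W̊_2^r(-1, 1)`, extended to the line: it is square
integrable, and its iterated primitives up to order `r` vanish at the right endpoint. -/
structure IsTopDeriv (r : ℕ) (g : ℝ → ℝ) : Prop where
  memLp : MemLp g 2 volume
  primitive_one : ∀ j < r, primitive^[j + 1] g 1 = 0

theorem IsTopDeriv.locallyIntegrable {r : ℕ} {g : ℝ → ℝ} (hg : IsTopDeriv r g) :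
    LocallyIntegrable g volume :=
  hg.memLp.locallyIntegrable one_le_two

theorem IsTopDeriv.const_mul {r : ℕ} {g : ℝ → ℝ} (hg : IsTopDeriv r g) (c : ℝ) :
    IsTopDeriv r fun t => c * g t :=
  ⟨hg.memLp.const_mul c, fun j hj => by
    rw [primitive_iterate_const_mul, hg.primitive_one j hj, mul_zero]⟩

open Polynomial in
theorem integral_polynomial_mul_eq_zero {r : ℕ} {g : ℝ → ℝ} (hg : LocallyIntegrable g volume)
    (h1 : ∀ j < r, primitive^[j + 1] g 1 = 0) (p : ℝ[X]) (hp : derivative^[r] p = 0) :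
    ∫ t in (-1 : ℝ)..1, p.eval t * g t = 0 := by
  induction r generalizing g p with
  | zero =>
    have : p = 0 := hp
    simp [this]
  | succ r ih =>
    have h0 : primitive g 1 = 0 := h1 0 (by omega)
    rw [integral_mul_eq_sub_integral_deriv_mul_primitive hg (fun t => p.hasDerivAt t)
      (derivative p).continuous, h0, mul_zero, zero_sub, neg_eq_zero]
    refine ih (continuous_primitive hg).locallyIntegrable (fun j hj => ?_) _ hp
    rw [← Function.iterate_succ_apply]
    exact h1 (j + 1) (by omega)

theorem IsTopDeriv.integral_legendre_mul {r n : ℕ} {g : ℝ → ℝ} (hg : IsTopDeriv r g) (hn : n < r) :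
    ∫ t in (-1 : ℝ)..1, (legendre n).eval t * g t = 0 :=
  integral_polynomial_mul_eq_zero hg.locallyIntegrable hg.primitive_one _
    (Polynomial.iterate_derivative_eq_zero ((natDegree_legendre_le n).trans_lt hn))

/-- Orthogonality to the Legendre polynomials of degree less than `r` implies orthogonality to the
functions `(1 - t)^j Pₙ` of degree less than `r`, by the three-term recursion. -/
theorem integral_one_sub_pow_mul_legendre_mul {r : ℕ} {g : ℝ → ℝ}
    (hg : LocallyIntegrable g volume)
    (h : ∀ n < r, ∫ t in (-1 : ℝ)..1, (legendre n).eval t * g t = 0) (j n : ℕ) (hjn : j + n < r) :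
    ∫ t in (-1 : ℝ)..1, (1 - t) ^ j * (legendre n).eval t * g t = 0 := by
  have ii : ∀ (j n : ℕ), IntervalIntegrable
      (fun t => (1 - t) ^ j * (legendre n).eval t * g t) volume (-1) 1 := fun j n =>
    (intervalIntegrable_of_locallyIntegrable hg _ _).continuousOn_mul
      (Continuous.continuousOn (by fun_prop))
  induction j generalizing n with
  | zero => simpa using h n (by omega)
  | succ j ih =>
    cases n with
    | zero =>
      have e : ∀ t, (1 - t) ^ (j + 1) * (legendre 0).eval t * g t =
          (1 - t) ^ j * (legendre 0).eval t * g t - (1 - t) ^ j * (legendre 1).eval t * g t := by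
        intro t
        simp [legendre]
        ring
      rw [intervalIntegral.integral_congr (fun t _ => e t),
        intervalIntegral.integral_sub (ii _ _) (ii _ _), ih 0 (by omega), ih 1 (by omega), sub_zero]
    | succ n =>
      have e : ∀ t, (1 - t) ^ (j + 1) * (legendre (n + 1)).eval t * g t =
          (1 - t) ^ j * (legendre (n + 1)).eval t * g t -
          (((n : ℝ) + 2) / (2 * n + 3) * ((1 - t) ^ j * (legendre (n + 2)).eval t * g t) +
          ((n : ℝ) + 1) / (2 * n + 3) * ((1 - t) ^ j * (legendre n).eval t * g t)) := by
        intro t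
        have hb := congrArg (Polynomial.eval t) (legendre_bonnet n)
        simp only [Polynomial.eval_mul, Polynomial.eval_sub, Polynomial.eval_add,
          Polynomial.eval_natCast, Polynomial.eval_ofNat, Polynomial.eval_X,
          Polynomial.eval_one] at hb
        have h3 : (2 * (n : ℝ) + 3) ≠ 0 := by positivity
        field_simp
        linear_combination (1 - t) ^ j * g t * hb
      rw [intervalIntegral.integral_congr (fun t _ => e t),
        intervalIntegral.integral_sub (ii _ _)
          (((ii _ _).const_mul _).add ((ii _ _).const_mul _)),
        intervalIntegral.integral_add ((ii _ _).const_mul _) ((ii _ _).const_mul _),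
        intervalIntegral.integral_const_mul, intervalIntegral.integral_const_mul,
        ih (n + 1) (by omega), ih (n + 2) (by omega), ih n (by omega)]
      simp

theorem isTopDeriv_of_integral_legendre_mul {r : ℕ} {g : ℝ → ℝ} (hg : MemLp g 2 volume)
    (h : ∀ n < r, ∫ t in (-1 : ℝ)..1, (legendre n).eval t * g t = 0) : IsTopDeriv r g := by
  have hl : LocallyIntegrable g volume := hg.locallyIntegrable one_le_two
  refine ⟨hg, fun j hj => ?_⟩
  have h0 := integral_one_sub_pow_mul_legendre_mul hl h j 0 (by omega)
  rw [primitive_iterate_eq_integral hl]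
  have e : ∀ t : ℝ, (1 - t) ^ j / j ! * g t =
      (j ! : ℝ)⁻¹ * ((1 - t) ^ j * (legendre 0).eval t * g t) := by
    intro t
    simp [legendre]
    ring
  rw [intervalIntegral.integral_congr (fun t _ => e t), intervalIntegral.integral_const_mul, h0,
    mul_zero]

theorem IsTopDeriv.primitive_iterate_comp_neg {r : ℕ} {g : ℝ → ℝ} (hg : IsTopDeriv r g) {j : ℕ}
    (hj : j ≤ r) (x : ℝ) :
    primitive^[j] (fun t => g (-t)) x = (-1) ^ j * primitive^[j] g (-x) := by
  induction j generalizing x with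
  | zero => simp
  | succ j ih =>
    have hl : LocallyIntegrable (primitive^[j] g) volume := by
      cases j with
      | zero => exact hg.locallyIntegrable
      | succ j => exact (continuous_primitive_iterate hg.locallyIntegrable j).locallyIntegrable
    have h1 := hg.primitive_one j (by omega)
    rw [Function.iterate_succ_apply', primitive] at h1
    rw [Function.iterate_succ_apply', Function.iterate_succ_apply', primitive, primitive,
      intervalIntegral.integral_congr (fun t _ => ih (by omega) t),
      intervalIntegral.integral_const_mul, intervalIntegral.integral_comp_neg, neg_neg,
      ← intervalIntegral.integral_add_adjacent_intervals
        (intervalIntegrable_of_locallyIntegrable hl (-x) (-1))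
        (intervalIntegrable_of_locallyIntegrable hl (-1) 1), h1,
      intervalIntegral.integral_symm (-1) (-x)]
    ring

/-- The reflection of the function induces this operation on its `r`-th derivative. -/
theorem IsTopDeriv.reflect {r : ℕ} {g : ℝ → ℝ} (hg : IsTopDeriv r g) :
    IsTopDeriv r fun t => (-1) ^ r * g (-t) := by
  refine IsTopDeriv.const_mul (g := fun t => g (-t)) ⟨?_, fun j hj => ?_⟩ _
  · exact hg.memLp.comp_measurePreserving (Measure.measurePreserving_neg volume)
  · rw [hg.primitive_iterate_comp_neg hj, primitive_iterate_neg_one, mul_zero]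

/-! ### The space `W̊_2^r(-1, 1)` through `r`-th derivatives -/

theorem uniqueDiffOn_J : UniqueDiffOn ℝ J := uniqueDiffOn_Icc (by norm_num)

theorem D_succ (j : ℕ) (f : ℝ → ℝ) {x : ℝ} (hx : x ∈ Ioo (-1 : ℝ) 1) :
    D (j + 1) f x = deriv (D j f) x := by
  rw [D, iteratedDerivWithin_succ, derivWithin_of_mem_nhds (Icc_mem_nhds hx.1 hx.2)]

theorem ae_ne_endpoints : ∀ᵐ x : ℝ, x ≠ -1 ∧ x ≠ 1 := by
  have h1 : ∀ᵐ x : ℝ, x ≠ -1 := by simp [ae_iff, measure_singleton]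
  have h2 : ∀ᵐ x : ℝ, x ≠ 1 := by simp [ae_iff, measure_singleton]
  filter_upwards [h1, h2] with x a b using ⟨a, b⟩

/-- The `r`-th derivative, extended by zero. -/
noncomputable def topDeriv (r : ℕ) (f : ℝ → ℝ) : ℝ → ℝ := J.indicator (D r f)

theorem MemW.D_eq_primitive {r : ℕ} {f : ℝ → ℝ} (hf : MemW r 2 f) {i : ℕ} (hi : i + 1 ≤ r)
    {x : ℝ} (hx : x ∈ J) : D (r - (i + 1)) f x = primitive^[i + 1] (topDeriv r f) x := by
  induction i generalizing x with
  | zero =>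
    have hac := hf.absolutelyContinuous.mono (c := -1) (d := x) (by
      rw [uIcc_of_le hx.1, uIcc_of_le (by norm_num)]
      exact Icc_subset_Icc le_rfl hx.2)
    have h := hac.integral_deriv_eq_sub
    rw [hf.left_eq_zero _ (by omega), sub_zero] at h
    rw [zero_add, ← h, Function.iterate_one, primitive]
    refine intervalIntegral.integral_congr_ae ?_
    filter_upwards [ae_ne_endpoints] with t ht htx
    rw [uIoc_of_le hx.1] at htx
    have ht' : t ∈ Ioo (-1 : ℝ) 1 := ⟨htx.1, lt_of_le_of_ne (htx.2.trans hx.2) ht.2⟩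
    rw [topDeriv, indicator_of_mem (Ioo_subset_Icc_self ht')]
    conv_rhs => rw [show r = (r - 1) + 1 by omega]
    exact (D_succ _ f ht').symm
  | succ i ih =>
    have e : r - (i + 1) = r - (i + 1 + 1) + 1 := by omega
    have hd : DifferentiableOn ℝ (D (r - (i + 1 + 1)) f) J :=
      hf.contDiffOn.differentiableOn_iteratedDerivWithin
        (by exact_mod_cast (show r - (i + 1 + 1) < r - 1 by omega)) uniqueDiffOn_J
    have hc : ContinuousOn (D (r - (i + 1)) f) J :=
      hf.contDiffOn.continuousOn_iteratedDerivWithin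
        (by exact_mod_cast (show r - (i + 1) ≤ r - 1 by omega)) uniqueDiffOn_J
    have hsub : Icc (-1) x ⊆ J := Icc_subset_Icc le_rfl hx.2
    have h := intervalIntegral.integral_eq_sub_of_hasDerivAt_of_le hx.1 (hd.continuousOn.mono hsub)
      (f' := D (r - (i + 1)) f) (fun t ht => by
        have ht' : t ∈ Ioo (-1 : ℝ) 1 := ⟨ht.1, ht.2.trans_le hx.2⟩
        rw [e, D_succ _ f ht']
        exact ((hd t (Ioo_subset_Icc_self ht')).differentiableAt
          (Icc_mem_nhds ht'.1 ht'.2)).hasDerivAt)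
      ((hc.mono hsub).intervalIntegrable_of_Icc hx.1)
    rw [hf.left_eq_zero _ (by omega), sub_zero] at h
    rw [← h, Function.iterate_succ_apply']
    exact primitive_congr hx fun t ht => ih (by omega) ht

theorem MemW.isTopDeriv {r : ℕ} {f : ℝ → ℝ} (hf : MemW r 2 f) : IsTopDeriv r (topDeriv r f) := by
  refine ⟨(memLp_indicator_iff_restrict measurableSet_Icc).mpr hf.memLp, fun j hj => ?_⟩
  rw [← hf.D_eq_primitive hj (right_mem_Icc.mpr (by norm_num))]
  exact hf.right_eq_zero _ (by omega)

theorem D_primitive_iterate {g : ℝ → ℝ} (hg : LocallyIntegrable g volume) {i j : ℕ} {x : ℝ}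
    (hx : x ∈ J) : D j (primitive^[i + 1 + j] g) x = primitive^[i + 1] g x := by
  induction j generalizing i x with
  | zero => rfl
  | succ j ih =>
    have h : D (j + 1) (primitive^[i + 1 + (j + 1)] g) x =
        derivWithin (primitive^[i + 1 + 1] g) J x := by
      rw [D, iteratedDerivWithin_succ]
      refine derivWithin_congr (fun y hy => ?_) ?_
      · rw [show i + 1 + (j + 1) = i + 1 + 1 + j by ring]; exact ih hy
      · rw [show i + 1 + (j + 1) = i + 1 + 1 + j by ring]; exact ih hx
    rw [h, Function.iterate_succ_apply']
    exact (hasDerivAt_primitive (continuous_primitive_iterate hg i) x).hasDerivWithinAt.derivWithin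
      (uniqueDiffOn_J x hx)

theorem D_primitive_iterate_ae {g : ℝ → ℝ} (hg : LocallyIntegrable g volume) (r : ℕ) :
    ∀ᵐ x ∂(volume.restrict J), D (r + 1) (primitive^[r + 1] g) x = g x := by
  rw [ae_restrict_iff' measurableSet_Icc]
  filter_upwards [LocallyIntegrable.ae_hasDerivAt_integral hg, ae_ne_endpoints] with x hx hne hxJ
  have hx' : x ∈ Ioo (-1 : ℝ) 1 := ⟨lt_of_le_of_ne hxJ.1 hne.1.symm, lt_of_le_of_ne hxJ.2 hne.2⟩
  have h1 : HasDerivAt (primitive g) (g x) x := hx (-1)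
  rw [D_succ _ _ hx', ← h1.deriv]
  refine Filter.EventuallyEq.deriv_eq ?_
  filter_upwards [Icc_mem_nhds hx'.1 hx'.2] with y hy
  have := D_primitive_iterate hg (i := 0) (j := r) hy
  rwa [zero_add, add_comm 1 r] at this

theorem IsTopDeriv.memW {r : ℕ} {g : ℝ → ℝ} (hg : IsTopDeriv (r + 1) g) :
    MemW (r + 1) 2 (primitive^[r + 1] g) := by
  have hl := hg.locallyIntegrable
  have hD : ∀ j < r + 1, EqOn (D j (primitive^[r + 1] g)) (primitive^[r - j + 1] g) J := by
    intro j hj x hx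
    have := D_primitive_iterate hl (i := r - j) (j := j) hx
    rwa [show r - j + 1 + j = r + 1 by omega] at this
  refine ⟨?_, ?_, ?_, fun j hj => ?_, fun j hj => ?_⟩
  · refine contDiffOn_of_continuousOn_differentiableOn_deriv (n := ((r + 1 - 1 : ℕ) : ℕ∞))
      (fun j hj => ?_) (fun j hj => ?_)
    · have hj' : j < r + 1 := by
        have : j ≤ r + 1 - 1 := by exact_mod_cast hj
        omega
      exact (continuous_primitive_iterate hl (r - j)).continuousOn.congr (hD j hj')
    · have hj' : j < r := by
        have : j < r + 1 - 1 := by exact_mod_cast hj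
        omega
      refine DifferentiableOn.congr (f := primitive^[r - j + 1] g) (fun x _ => ?_)
        (hD j (by omega))
      rw [Function.iterate_succ_apply', show r - j = (r - j - 1) + 1 by omega]
      exact (hasDerivAt_primitive (continuous_primitive_iterate hl _)
        x).differentiableAt.differentiableWithinAt
  · have hac : AbsolutelyContinuousOnInterval (primitive g) (-1) 1 :=
      (intervalIntegrable_of_locallyIntegrable hl
        (-1) 1).absolutelyContinuousOnInterval_intervalIntegral left_mem_uIcc
    rw [absolutelyContinuousOnInterval_iff] at hac ⊢
    intro ε hε
    obtain ⟨δ, hδ, h⟩ := hac ε hε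
    refine ⟨δ, hδ, fun E hE hlt => lt_of_eq_of_lt ?_ (h E hE hlt)⟩
    refine Finset.sum_congr rfl fun i hi => ?_
    have hmem := hE.1 i hi
    rw [uIcc_of_le (by norm_num)] at hmem
    have := hD r (by omega)
    rw [Nat.sub_self] at this
    rw [Nat.add_sub_cancel, this hmem.1, this hmem.2]
    rfl
  · exact (hg.memLp.restrict J).ae_eq
      ((D_primitive_iterate_ae hl r).mono fun x hx => hx.symm)
  · rw [hD j hj (left_mem_Icc.mpr (by norm_num)), primitive_iterate_neg_one]
  · rw [hD j hj (right_mem_Icc.mpr (by norm_num))]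
    exact hg.primitive_one _ (by omega)

/-! ### The representing function of a point evaluation -/

theorem intervalIntegrable_mul {f g : ℝ → ℝ} (hf : MemLp f 2 volume) (hg : MemLp g 2 volume)
    (a b : ℝ) : IntervalIntegrable (fun t => f t * g t) volume a b :=
  (MemLp.integrable_mul hf hg).intervalIntegrable

theorem integral_const_mul_add_sq {f g : ℝ → ℝ} (hf : MemLp f 2 volume) (hg : MemLp g 2 volume)
    (c : ℝ) : ∫ t in (-1 : ℝ)..1, (c * f t + g t) * (c * f t + g t) =
      c ^ 2 * (∫ t in (-1 : ℝ)..1, f t * f t) + 2 * c * (∫ t in (-1 : ℝ)..1, f t * g t) +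
        ∫ t in (-1 : ℝ)..1, g t * g t := by
  have e : ∀ t, (c * f t + g t) * (c * f t + g t) =
      c ^ 2 * (f t * f t) + 2 * c * (f t * g t) + g t * g t := fun t => by ring
  rw [intervalIntegral.integral_congr (fun t _ => e t), intervalIntegral.integral_add
      (((intervalIntegrable_mul hf hf _ _).const_mul _).add
        ((intervalIntegrable_mul hf hg _ _).const_mul _)) (intervalIntegrable_mul hg hg _ _),
    intervalIntegral.integral_add ((intervalIntegrable_mul hf hf _ _).const_mul _)
        ((intervalIntegrable_mul hf hg _ _).const_mul _),
    intervalIntegral.integral_const_mul, intervalIntegral.integral_const_mul]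

theorem integral_mul_sq_le {f g : ℝ → ℝ} (hf : MemLp f 2 volume) (hg : MemLp g 2 volume) :
    (∫ t in (-1 : ℝ)..1, f t * g t) ^ 2 ≤
      (∫ t in (-1 : ℝ)..1, f t * f t) * ∫ t in (-1 : ℝ)..1, g t * g t := by
  have h := discrim_le_zero (a := ∫ t in (-1 : ℝ)..1, f t * f t)
    (b := 2 * ∫ t in (-1 : ℝ)..1, f t * g t) (c := ∫ t in (-1 : ℝ)..1, g t * g t) fun c => by
      have h0 : 0 ≤ ∫ t in (-1 : ℝ)..1, (c * f t + g t) * (c * f t + g t) :=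
        intervalIntegral.integral_nonneg (by norm_num) fun t _ => mul_self_nonneg _
      rw [integral_const_mul_add_sq hf hg] at h0
      linarith
  rw [discrim] at h
  linarith

/-- The truncated power `(x - t)₊^m / m!`, as a function of `t`. -/
noncomputable def truncPow (m : ℕ) (x : ℝ) : ℝ → ℝ :=
  (Iio x).indicator fun t => (x - t) ^ m / m !

theorem integral_truncPow_mul (m : ℕ) {x : ℝ} (hx : x ∈ J) {h : ℝ → ℝ}
    (hh : LocallyIntegrable h volume) :
    ∫ t in (-1 : ℝ)..1, truncPow m x t * h t = ∫ t in (-1 : ℝ)..x, (x - t) ^ m / m ! * h t := by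
  have e1 : ∀ᵐ t : ℝ, t ∈ uIoc (-1) x → (x - t) ^ m / m ! * h t = truncPow m x t * h t := by
    have hne : ∀ᵐ t : ℝ, t ≠ x := by simp [ae_iff, measure_singleton]
    filter_upwards [hne] with t ht htx
    rw [uIoc_of_le hx.1] at htx
    rw [truncPow, indicator_of_mem (show t ∈ Iio x from lt_of_le_of_ne htx.2 ht)]
  have e2 : ∀ᵐ t : ℝ, t ∈ uIoc x 1 → (0 : ℝ) = truncPow m x t * h t := by
    refine Filter.Eventually.of_forall fun t ht => ?_
    rw [uIoc_of_le hx.2] at ht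
    rw [truncPow, indicator_of_notMem (by simpa using ht.1.le), zero_mul]
  have i0 : IntervalIntegrable (fun t => (x - t) ^ m / m ! * h t) volume (-1) x :=
    (intervalIntegrable_of_locallyIntegrable hh (-1) x).continuousOn_mul
      (Continuous.continuousOn (by fun_prop))
  have i1 : IntervalIntegrable (fun t => truncPow m x t * h t) volume (-1) x :=
    i0.congr_ae ((ae_restrict_iff' measurableSet_uIoc).mpr e1)
  have i2 : IntervalIntegrable (fun t => truncPow m x t * h t) volume x 1 :=
    (IntervalIntegrable.zero (μ := volume)).congr_ae
      ((ae_restrict_iff' measurableSet_uIoc).mpr e2)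
  rw [← intervalIntegral.integral_add_adjacent_intervals i1 i2,
    ← intervalIntegral.integral_congr_ae e1, ← intervalIntegral.integral_congr_ae e2]
  simp

theorem memLp_indicator_J {u : ℝ → ℝ} (hu : Continuous u) : MemLp (J.indicator u) 2 volume := by
  rw [memLp_indicator_iff_restrict measurableSet_Icc]
  obtain ⟨C, hC⟩ := isCompact_Icc.exists_bound_of_continuousOn (hu.continuousOn (s := J))
  refine MemLp.of_bound hu.aestronglyMeasurable C ?_
  rw [ae_restrict_iff' measurableSet_Icc]
  exact Filter.Eventually.of_forall hC

theorem integral_indicator_J_mul (u h : ℝ → ℝ) :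
    ∫ t in (-1 : ℝ)..1, J.indicator u t * h t = ∫ t in (-1 : ℝ)..1, u t * h t := by
  refine intervalIntegral.integral_congr fun t ht => ?_
  rw [uIcc_of_le (by norm_num)] at ht
  rw [indicator_of_mem ht]

/-- The difference of the truncated power `truncPow m x` and its orthogonal projection to the
polynomials of degree less than `r`, extended by zero outside `[-1, 1]`. It represents the functional
`g ↦ primitive^[m + 1] g x` on `IsTopDeriv r`. -/
noncomputable def reprFun (m r : ℕ) (x : ℝ) : ℝ → ℝ :=
  J.indicator fun t => truncPow m x t -
    ∑ n ∈ Finset.range r, (((n : ℝ) + 1 / 2) * legendrePrim (m + 1) n x) * (legendre n).eval t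

theorem memLp_indicator_truncPow (m : ℕ) (x : ℝ) :
    MemLp (J.indicator (truncPow m x)) 2 volume := by
  have h := (memLp_indicator_J (u := fun t => (x - t) ^ m / m !) (by fun_prop)).indicator
    (measurableSet_Iio (a := x))
  rwa [indicator_indicator, inter_comm, ← indicator_indicator] at h

theorem memLp_reprFun (m r : ℕ) (x : ℝ) : MemLp (reprFun m r x) 2 volume := by
  have h := (memLp_indicator_truncPow m x).sub (memLp_indicator_J (u := fun t =>
    ∑ n ∈ Finset.range r, (((n : ℝ) + 1 / 2) * legendrePrim (m + 1) n x) * (legendre n).eval t)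
    (by fun_prop))
  rwa [← indicator_sub'] at h

theorem integral_reprFun_mul (m r : ℕ) {x : ℝ} (hx : x ∈ J) {h : ℝ → ℝ}
    (hh : LocallyIntegrable h volume) : ∫ t in (-1 : ℝ)..1, reprFun m r x t * h t =
      primitive^[m + 1] h x - ∑ n ∈ Finset.range r, (((n : ℝ) + 1 / 2) * legendrePrim (m + 1) n x) *
        ∫ t in (-1 : ℝ)..1, (legendre n).eval t * h t := by
  have hi : ∀ u : ℝ → ℝ, Continuous u → IntervalIntegrable (fun t => u t * h t) volume (-1) 1 :=
    fun u hu => (intervalIntegrable_of_locallyIntegrable hh _ _).continuousOn_mul hu.continuousOn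
  have ht : IntervalIntegrable (fun t => truncPow m x t * h t) volume (-1) 1 := by
    have := hi (fun t => (x - t) ^ m / m !) (by fun_prop)
    rw [intervalIntegrable_iff] at this ⊢
    have h2 := this.indicator (measurableSet_Iio (a := x))
    refine h2.congr_fun (fun t _ => ?_) measurableSet_uIoc
    by_cases htx : t < x <;> simp [truncPow, htx]
  rw [reprFun, integral_indicator_J_mul]
  simp only [sub_mul, Finset.sum_mul]
  rw [intervalIntegral.integral_sub ht, integral_truncPow_mul m hx hh,
    primitive_iterate_eq_integral hh, intervalIntegral.integral_finsetSum]
  · simp only [mul_assoc _ (Polynomial.eval _ _), intervalIntegral.integral_const_mul]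
  · exact fun n _ => hi _ (by fun_prop)
  · have := hi (fun t => ∑ n ∈ Finset.range r, (((n : ℝ) + 1 / 2) * legendrePrim (m + 1) n x) *
      (legendre n).eval t) (by fun_prop)
    simpa only [Finset.sum_mul] using this

theorem integral_legendre_mul_reprFun (m : ℕ) {r n : ℕ} (hn : n < r) {x : ℝ} (hx : x ∈ J) :
    ∫ t in (-1 : ℝ)..1, (legendre n).eval t * reprFun m r x t = 0 := by
  simp only [mul_comm _ (reprFun m r x _)]
  rw [integral_reprFun_mul m r hx (legendre n).continuous.locallyIntegrable,
    Finset.sum_eq_single_of_mem n (Finset.mem_range.mpr hn)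
      (fun l _ hl => by rw [integral_legendre_mul_legendre_of_ne hl, mul_zero]),
    integral_legendre_sq]
  have : (2 * (n : ℝ) + 1) ≠ 0 := by positivity
  change legendrePrim (m + 1) n x - _ = 0
  field_simp
  ring

theorem isTopDeriv_reprFun (m r : ℕ) {x : ℝ} (hx : x ∈ J) : IsTopDeriv r (reprFun m r x) :=
  isTopDeriv_of_integral_legendre_mul (memLp_reprFun m r x)
    fun _ hn => integral_legendre_mul_reprFun m hn hx

theorem IsTopDeriv.integral_mul_reprFun {r : ℕ} {g : ℝ → ℝ} (hg : IsTopDeriv r g) (m : ℕ) {x : ℝ}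
    (hx : x ∈ J) : ∫ t in (-1 : ℝ)..1, g t * reprFun m r x t = primitive^[m + 1] g x := by
  simp only [mul_comm _ (reprFun m r x _)]
  rw [integral_reprFun_mul m r hx hg.locallyIntegrable, Finset.sum_eq_zero, sub_zero]
  intro n hn
  rw [hg.integral_legendre_mul (Finset.mem_range.mp hn), mul_zero]

theorem primitive_iterate_reprFun (m r : ℕ) {x : ℝ} (hx : x ∈ J) :
    primitive^[m + 1] (reprFun m r x) x = sqDist m r x := by
  have hl := (memLp_indicator_truncPow m x).locallyIntegrable one_le_two
  -- only the truncated power contributes to the norm of its component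
  have h1 : primitive^[m + 1] (reprFun m r x) x =
      ∫ t in (-1 : ℝ)..1, reprFun m r x t * J.indicator (truncPow m x) t := by
    rw [primitive_iterate_eq_integral (isTopDeriv_reprFun m r hx).locallyIntegrable,
      ← integral_truncPow_mul m hx (isTopDeriv_reprFun m r hx).locallyIntegrable,
      ← integral_indicator_J_mul]
    simp only [mul_comm]
  have h2 : primitive^[m + 1] (J.indicator (truncPow m x)) x =
      (1 + x) ^ (2 * m + 1) / ((2 * m + 1) * (m ! : ℝ) ^ 2) := by
    rw [primitive_iterate_eq_integral hl]
    have e : ∀ᵐ t : ℝ, t ∈ uIoc (-1) x → (x - t) ^ m / m ! * J.indicator (truncPow m x) t =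
        ((m ! : ℝ) ^ 2)⁻¹ * (x - t) ^ (2 * m) := by
      have hne : ∀ᵐ t : ℝ, t ≠ x := by simp [ae_iff, measure_singleton]
      filter_upwards [hne] with t ht htx
      rw [uIoc_of_le hx.1] at htx
      rw [indicator_of_mem (show t ∈ J from ⟨htx.1.le, htx.2.trans hx.2⟩), truncPow,
        indicator_of_mem (show t ∈ Iio x from lt_of_le_of_ne htx.2 ht)]
      field_simp
      ring
    rw [intervalIntegral.integral_congr_ae e, intervalIntegral.integral_const_mul,
      intervalIntegral.integral_comp_sub_left (fun t => t ^ (2 * m)), integral_pow]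
    push_cast
    rw [sub_self, zero_pow (by omega), sub_zero, sub_neg_eq_add, add_comm x 1]
    field_simp
  rw [h1, integral_reprFun_mul m r hx hl, h2, sqDist]
  congr 1
  refine Finset.sum_congr rfl fun n _ => ?_
  have h3 : ∫ t in (-1 : ℝ)..1, (legendre n).eval t * J.indicator (truncPow m x) t =
      legendrePrim (m + 1) n x := by
    simp only [mul_comm _ (J.indicator _ _)]
    rw [integral_indicator_J_mul,
      integral_truncPow_mul m hx (legendre n).continuous.locallyIntegrable,
      ← primitive_iterate_eq_integral (legendre n).continuous.locallyIntegrable]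
    rfl
  rw [h3]
  ring

theorem integral_reprFun_sq (m r : ℕ) {x : ℝ} (hx : x ∈ J) :
    ∫ t in (-1 : ℝ)..1, reprFun m r x t * reprFun m r x t = sqDist m r x := by
  rw [(isTopDeriv_reprFun m r hx).integral_mul_reprFun m hx, primitive_iterate_reprFun m r hx]

theorem sqDist_nonneg (m r : ℕ) {x : ℝ} (hx : x ∈ J) : 0 ≤ sqDist m r x := by
  rw [← integral_reprFun_sq m r hx]
  exact intervalIntegral.integral_nonneg (by norm_num) fun t _ => mul_self_nonneg _

theorem normLp_two_sq {h : ℝ → ℝ} (hh : MemLp h 2 (volume.restrict J)) :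
    normLp 2 h ^ 2 = ∫ t in (-1 : ℝ)..1, h t * h t := by
  have h0 : 0 ≤ ∫ t in J, ‖h t‖ ^ (2 : ℝ) :=
    integral_nonneg fun t => Real.rpow_nonneg (norm_nonneg _) _
  rw [normLp, hh.eLpNorm_eq_integral_rpow_norm two_ne_zero ENNReal.ofNat_ne_top,
    ENNReal.toReal_ofReal (Real.rpow_nonneg (by simpa using h0) _)]
  simp only [ENNReal.toReal_ofNat]
  rw [← Real.rpow_natCast, ← Real.rpow_mul h0, intervalIntegral.integral_of_le (by norm_num),
    integral_Icc_eq_integral_Ioc]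
  norm_num
  simp only [← pow_two]

theorem normLp_two_topDeriv_sq {r : ℕ} {f : ℝ → ℝ} (hf : MemW r 2 f) :
    normLp 2 (D r f) ^ 2 = ∫ t in (-1 : ℝ)..1, topDeriv r f t * topDeriv r f t := by
  rw [normLp_two_sq hf.memLp]
  refine intervalIntegral.integral_congr fun t ht => ?_
  rw [uIcc_of_le (by norm_num)] at ht
  simp only [topDeriv]
  rw [indicator_of_mem ht]

theorem MemW.D_sq_le {m r : ℕ} {f : ℝ → ℝ} (hf : MemW r 2 f) (hm : m + 1 ≤ r) {x : ℝ}
    (hx : x ∈ J) : D (r - (m + 1)) f x ^ 2 ≤ normLp 2 (D r f) ^ 2 * sqDist m r x := by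
  rw [hf.D_eq_primitive hm hx, ← hf.isTopDeriv.integral_mul_reprFun m hx,
    normLp_two_topDeriv_sq hf, ← integral_reprFun_sq m r hx]
  exact integral_mul_sq_le hf.isTopDeriv.memLp (memLp_reprFun m r x)

/-- The element of `W̊_2^r(-1, 1)` whose `r`-th derivative is `c • reprFun m r x`. -/
noncomputable def reprPrim (m r : ℕ) (x c : ℝ) : ℝ → ℝ :=
  primitive^[r] fun t => c * reprFun m r x t

theorem memW_reprPrim {m r : ℕ} (hm : m + 1 ≤ r) {x : ℝ} (hx : x ∈ J) (c : ℝ) :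
    MemW r 2 (reprPrim m r x c) := by
  obtain ⟨r, rfl⟩ : ∃ s, r = s + 1 := ⟨r - 1, by omega⟩
  exact ((isTopDeriv_reprFun m _ hx).const_mul c).memW

theorem D_reprPrim {m r : ℕ} (hm : m + 1 ≤ r) {x : ℝ} (hx : x ∈ J) (c : ℝ) :
    D (r - (m + 1)) (reprPrim m r x c) x = c * sqDist m r x := by
  have h := D_primitive_iterate ((isTopDeriv_reprFun m r hx).const_mul c).locallyIntegrable
    (i := m) (j := r - (m + 1)) hx
  rw [show m + 1 + (r - (m + 1)) = r by omega] at h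
  rw [reprPrim, h, primitive_iterate_const_mul, primitive_iterate_reprFun m r hx]

theorem normLp_two_reprPrim_sq {m r : ℕ} (hm : m + 1 ≤ r) {x : ℝ} (hx : x ∈ J) (c : ℝ) :
    normLp 2 (D r (reprPrim m r x c)) ^ 2 = c ^ 2 * sqDist m r x := by
  have hg := (isTopDeriv_reprFun m r hx).const_mul c
  rw [normLp_two_sq (memW_reprPrim hm hx c).memLp, ← integral_reprFun_sq m r hx,
    ← intervalIntegral.integral_const_mul]
  obtain ⟨r, rfl⟩ : ∃ s, r = s + 1 := ⟨r - 1, by omega⟩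
  refine intervalIntegral.integral_congr_ae ?_
  have h := D_primitive_iterate_ae hg.locallyIntegrable r
  rw [ae_restrict_iff' measurableSet_Icc] at h
  filter_upwards [h] with t ht htI
  rw [uIoc_of_le (by norm_num)] at htI
  rw [reprPrim, ht (Ioc_subset_Icc_self htI)]
  ring

theorem isGreatest_pointValues {m r : ℕ} (hm : m + 1 ≤ r) {x : ℝ} (hx : x ∈ J) :
    IsGreatest (pointValues r (r - (m + 1)) x) (√(sqDist m r x)) := by
  have h0 := sqDist_nonneg m r hx
  constructor
  · -- for `sqDist = 0` the scaling factor is `0` and the zero function is the maximizer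
    refine ⟨reprPrim m r x (√(sqDist m r x))⁻¹, memW_reprPrim hm hx _, ?_, ?_⟩
    · refine (sq_le_one_iff₀ ENNReal.toReal_nonneg).mp ?_
      rw [normLp_two_reprPrim_sq hm hx, inv_pow, Real.sq_sqrt h0]
      exact inv_mul_le_one
    · rw [D_reprPrim hm hx, abs_of_nonneg (mul_nonneg (inv_nonneg.mpr (Real.sqrt_nonneg _)) h0)]
      rcases h0.eq_or_lt with h | h
      · rw [← h]; simp
      · rw [eq_inv_mul_iff_mul_eq₀ (Real.sqrt_ne_zero'.mpr h), Real.mul_self_sqrt h0]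
  · rintro y ⟨f, hf, hn, rfl⟩
    refine Real.le_sqrt_of_sq_le ?_
    rw [sq_abs]
    refine (hf.D_sq_le hm hx).trans (mul_le_of_le_one_left h0 ?_)
    exact pow_le_one₀ ENNReal.toReal_nonneg hn

theorem A_eq_sqrt {m r : ℕ} (hm : m + 1 ≤ r) {x : ℝ} (hx : x ∈ J) :
    A r (r - (m + 1)) x = √(sqDist m r x) :=
  (isGreatest_pointValues hm hx).csSup_eq

/-! ### Extremals -/

theorem exists_normLp_top_eq {h : ℝ → ℝ} (hh : ContinuousOn h J) :
    ∃ x ∈ J, normLp ⊤ h = |h x| ∧ ∀ y ∈ J, |h y| ≤ |h x| := by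
  obtain ⟨x, hx, hmax⟩ := isCompact_Icc.exists_isMaxOn
    (nonempty_Icc.mpr (by norm_num : (-1 : ℝ) ≤ 1)) hh.abs
  refine ⟨x, hx, ?_, fun y hy => hmax hy⟩
  have hup : eLpNorm h ⊤ (volume.restrict J) ≤ ENNReal.ofReal |h x| := by
    rw [eLpNorm_exponent_top]
    refine eLpNormEssSup_le_of_ae_bound ?_
    rw [ae_restrict_iff' measurableSet_Icc]
    exact Filter.Eventually.of_forall fun y hy => hmax hy
  refine le_antisymm (ENNReal.toReal_le_of_le_ofReal (abs_nonneg _) hup) ?_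
  -- the a.e. bound on the open interval holds everywhere on its closure by continuity
  set c := normLp ⊤ h with hc
  have hae : ∀ᵐ y, y ∈ J → |h y| ≤ c := by
    rw [← ae_restrict_iff' measurableSet_Icc]
    filter_upwards [enorm_ae_le_eLpNormEssSup h (volume.restrict J)] with y hy
    rw [hc, normLp, eLpNorm_exponent_top, ← Real.norm_eq_abs, ← toReal_enorm]
    rw [eLpNorm_exponent_top] at hup
    exact ENNReal.toReal_mono (ne_top_of_le_ne_top ENNReal.ofReal_ne_top hup) hy
  have hdense : Dense {y | y ∈ J → |h y| ≤ c} := Measure.dense_of_ae hae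
  have hx' : x ∈ closure (Ioo (-1 : ℝ) 1 ∩ {y | y ∈ J → |h y| ≤ c}) := by
    have h1 := closure_mono (hdense.open_subset_closure_inter (isOpen_Ioo (a := -1) (b := 1)))
    rw [closure_closure, closure_Ioo (by norm_num)] at h1
    exact h1 hx
  have hcl := ((hh.abs x hx).mono
    (inter_subset_left.trans Ioo_subset_Icc_self)).mem_closure (t := Iic c) hx'
    fun y hy => hy.2 (Ioo_subset_Icc_self hy.1)
  rwa [isClosed_Iic.closure_eq] at hcl

theorem MemW.continuousOn_D {r k : ℕ} {p : ℝ≥0∞} {f : ℝ → ℝ} (hf : MemW r p f) (hk : k < r) :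
    ContinuousOn (D k f) J :=
  hf.contDiffOn.continuousOn_iteratedDerivWithin
    (by exact_mod_cast (show k ≤ r - 1 by omega)) uniqueDiffOn_J

theorem primitive_iterate_congr {g h : ℝ → ℝ} (hgh : EqOn g h J) (n : ℕ) :
    EqOn (primitive^[n] g) (primitive^[n] h) J := by
  induction n with
  | zero => exact hgh
  | succ n ih =>
    intro x hx
    rw [Function.iterate_succ_apply', Function.iterate_succ_apply']
    exact primitive_congr hx ih

theorem MemW.eq_primitive {r : ℕ} {f : ℝ → ℝ} (hf : MemW r 2 f) (hr : 1 ≤ r) {x : ℝ}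
    (hx : x ∈ J) : f x = primitive^[r] (topDeriv r f) x := by
  have h := hf.D_eq_primitive (i := r - 1) (by omega) hx
  rwa [show r - 1 + 1 = r by omega, Nat.sub_self, D, iteratedDerivWithin_zero] at h

theorem Admissible.exists_D_ne_zero {m r : ℕ} (hm : m + 1 ≤ r) {f : ℝ → ℝ}
    (hf : Admissible r 2 f) : ∃ x ∈ J, D (r - (m + 1)) f x ≠ 0 := by
  by_contra! h
  obtain ⟨hW, x, hx, hne⟩ := hf
  have hz : EqOn (primitive^[m + 1] (topDeriv r f)) (fun _ => 0 * 0) J := fun y hy => by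
    rw [← hW.D_eq_primitive hm hy, h y hy, mul_zero]
  have h2 := primitive_iterate_congr hz (r - (m + 1)) hx
  rw [← Function.iterate_add_apply, show r - (m + 1) + (m + 1) = r by omega,
    primitive_iterate_const_mul 0 (fun _ => 0), zero_mul] at h2
  exact hne ((hW.eq_primitive (by omega) hx).trans h2)

theorem admissible_reprPrim {m r : ℕ} (hm : m + 1 ≤ r) {x : ℝ} (hx : x ∈ J)
    (hpos : 0 < sqDist m r x) : Admissible r 2 (reprPrim m r x 1) := by
  refine ⟨memW_reprPrim hm hx 1, ?_⟩
  by_contra! h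
  have h1 := D_reprPrim hm hx 1
  have h2 : EqOn (D (r - (m + 1)) (reprPrim m r x 1)) (D (r - (m + 1)) (fun _ => 0)) J :=
    iteratedDerivWithin_congr h
  have h3 : D (r - (m + 1)) (fun _ => (0 : ℝ)) x = 0 := by
    simp [D]
  rw [h2 hx, h3, one_mul] at h1
  exact hpos.ne h1

/-- If `sqDist m r` is maximal at `0`, no admissible function has a ratio below
`(√(sqDist m r 0))⁻¹`, and the derivative of order `r - (m + 1)` of a function attaining this value
has its maximum modulus at a maximum point of `sqDist m r`. -/
theorem Admissible.le_ratio {m r : ℕ} (hm : m + 1 ≤ r) (hpos : 0 < sqDist m r 0)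
    (hmax : ∀ x ∈ J, sqDist m r x ≤ sqDist m r 0) {f : ℝ → ℝ} (hf : Admissible r 2 f) :
    (√(sqDist m r 0))⁻¹ ≤ ratio r (r - (m + 1)) 2 ⊤ f ∧
      (ratio r (r - (m + 1)) 2 ⊤ f = (√(sqDist m r 0))⁻¹ →
        ∃ x ∈ J, sqDist m r x = sqDist m r 0 ∧
          D (r - (m + 1)) f x ^ 2 = normLp 2 (D r f) ^ 2 * sqDist m r 0) := by
  obtain ⟨x, hx, hM, hle⟩ := exists_normLp_top_eq (hf.1.continuousOn_D
    (show r - (m + 1) < r by omega))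
  obtain ⟨y, hy, hy0⟩ := hf.exists_D_ne_zero hm
  have hMpos : 0 < |D (r - (m + 1)) f x| := (abs_pos.mpr hy0).trans_le (hle y hy)
  have hb := hf.1.D_sq_le hm hx
  have hN0 : 0 ≤ normLp 2 (D r f) := ENNReal.toReal_nonneg
  have hs := Real.sqrt_pos.mpr hpos
  have hNpos : 0 < normLp 2 (D r f) := by
    refine lt_of_le_of_ne hN0 fun h => ?_
    rw [← h, ← sq_abs] at hb
    have := pow_pos hMpos 2
    linarith
  have hb0 : normLp 2 (D r f) ^ 2 * sqDist m r x ≤ normLp 2 (D r f) ^ 2 * sqDist m r 0 :=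
    mul_le_mul_of_nonneg_left (hmax x hx) (sq_nonneg _)
  rw [ratio, hM]
  constructor
  · rw [inv_eq_one_div, div_le_div_iff₀ hs hMpos, one_mul]
    refine abs_le_of_sq_le_sq ?_ (mul_nonneg hN0 hs.le)
    rw [mul_pow, Real.sq_sqrt hpos.le]
    exact hb.trans hb0
  · intro h
    rw [inv_eq_one_div, div_eq_div_iff hMpos.ne' hs.ne', one_mul] at h
    have h2 : D (r - (m + 1)) f x ^ 2 = normLp 2 (D r f) ^ 2 * sqDist m r 0 := by
      rw [← sq_abs, ← h, mul_pow, Real.sq_sqrt hpos.le]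
    refine ⟨x, hx, le_antisymm (hmax x hx) ?_, h2⟩
    exact le_of_mul_le_mul_left (h2 ▸ hb) (pow_pos hNpos 2)

theorem ratio_reprPrim_le {m r : ℕ} (hm : m + 1 ≤ r) (hpos : 0 < sqDist m r 0) :
    ratio r (r - (m + 1)) 2 ⊤ (reprPrim m r 0 1) ≤ (√(sqDist m r 0))⁻¹ := by
  have h0 : (0 : ℝ) ∈ J := ⟨by norm_num, by norm_num⟩
  obtain ⟨x, hx, hM, hle⟩ := exists_normLp_top_eq ((memW_reprPrim hm h0 1).continuousOn_D
    (show r - (m + 1) < r by omega))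
  have h1 := hle 0 h0
  rw [D_reprPrim hm h0, one_mul, abs_of_pos hpos] at h1
  have hN : normLp 2 (D r (reprPrim m r 0 1)) = √(sqDist m r 0) := by
    have := normLp_two_reprPrim_sq hm h0 1
    rw [one_pow, one_mul] at this
    rw [← this, Real.sqrt_sq ENNReal.toReal_nonneg]
  have hs := Real.sqrt_pos.mpr hpos
  rw [ratio, hM, hN, inv_eq_one_div, div_le_div_iff₀ (hpos.trans_le h1) hs, one_mul,
    Real.mul_self_sqrt hpos.le]
  exact h1

/-- A function for which the Cauchy–Schwarz inequality behind the bound at `0` is an equality is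
even: otherwise the average of the function and its reflection would violate the bound. -/
theorem MemW.even_of_D_sq_eq {m r : ℕ} (hm : m + 1 ≤ r) (hk : Even (r - (m + 1)))
    (hpos : 0 < sqDist m r 0) {f : ℝ → ℝ} (hf : MemW r 2 f)
    (heq : D (r - (m + 1)) f 0 ^ 2 = normLp 2 (D r f) ^ 2 * sqDist m r 0) {x : ℝ} (hx : x ∈ J) :
    f (-x) = f x := by
  have h0 : (0 : ℝ) ∈ J := ⟨by norm_num, by norm_num⟩
  set g := topDeriv r f with hg
  have hT : IsTopDeriv r g := hf.isTopDeriv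
  set g' : ℝ → ℝ := fun t => (-1) ^ r * g (-t) with hg'
  have hT' : IsTopDeriv r g' := hT.reflect
  set b := primitive^[m + 1] g 0 with hb
  have hprim : ∀ (j : ℕ), j ≤ r → ∀ y, primitive^[j] g' y =
      (-1) ^ (r + j) * primitive^[j] g (-y) := by
    intro j hj y
    rw [hg', primitive_iterate_const_mul _ (fun t => g (-t)), hT.primitive_iterate_comp_neg hj,
      pow_add, mul_assoc]
  have hb' : primitive^[m + 1] g' 0 = b := by
    have he : Even (r + (m + 1)) := by
      obtain ⟨c, hc⟩ := hk
      exact ⟨c + (m + 1), by omega⟩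
    rw [hprim _ hm, he.neg_one_pow, one_mul, neg_zero]
  have hN : ∫ t in (-1 : ℝ)..1, g' t * g' t = ∫ t in (-1 : ℝ)..1, g t * g t := by
    have e : ∀ t, g' t * g' t = g (-t) * g (-t) := fun t => by
      have : ((-1 : ℝ) ^ r) * (-1) ^ r = 1 := by rw [← mul_pow]; norm_num
      simp only [hg']
      linear_combination (g (-t) * g (-t)) * this
    rw [intervalIntegral.integral_congr (fun t _ => e t),
      intervalIntegral.integral_comp_neg (fun t => g t * g t), neg_neg]
  have hcs := integral_mul_sq_le (hT.memLp.add hT'.memLp) (memLp_reprFun m r 0)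
  have hsum : ∫ t in (-1 : ℝ)..1, (g + g') t * reprFun m r 0 t = 2 * b := by
    have e : ∀ t, (g + g') t * reprFun m r 0 t = g t * reprFun m r 0 t + g' t * reprFun m r 0 t :=
      fun t => add_mul _ _ _
    rw [intervalIntegral.integral_congr (fun t _ => e t), intervalIntegral.integral_add
      (intervalIntegrable_mul hT.memLp (memLp_reprFun m r 0) _ _)
      (intervalIntegrable_mul hT'.memLp (memLp_reprFun m r 0) _ _),
      hT.integral_mul_reprFun m h0, hT'.integral_mul_reprFun m h0, hb']
    ring
  have hplus := integral_const_mul_add_sq hT.memLp hT'.memLp 1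
  have hminus := integral_const_mul_add_sq hT.memLp hT'.memLp (-1)
  have hplus' : ∫ t in (-1 : ℝ)..1, (g + g') t * (g + g') t =
      ∫ t in (-1 : ℝ)..1, (1 * g t + g' t) * (1 * g t + g' t) := by
    simp only [one_mul, Pi.add_apply]
  rw [hsum, integral_reprFun_sq m r h0, hplus', hplus, hN] at hcs
  rw [hf.D_eq_primitive hm h0, normLp_two_topDeriv_sq hf, ← hg, ← hb] at heq
  rw [hN] at hminus
  -- the parallelogram law leaves no room for `g' - g`
  have hz : ∫ t in (-1 : ℝ)..1, (-1 * g t + g' t) * (-1 * g t + g' t) = 0 := by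
    refine le_antisymm ?_ (intervalIntegral.integral_nonneg (by norm_num)
      fun t _ => mul_self_nonneg _)
    refine nonpos_of_mul_nonpos_left ?_ hpos
    rw [hminus]
    linarith
  have hae : ∀ᵐ t : ℝ, t ∈ Ioc (-1 : ℝ) 1 → g' t = g t := by
    rw [intervalIntegral.integral_of_le (by norm_num), integral_eq_zero_iff_of_nonneg
      (fun t => mul_self_nonneg _) ?_] at hz
    · filter_upwards [(ae_restrict_iff' measurableSet_Ioc).mp hz] with t ht htI
      have := mul_self_eq_zero.mp (ht htI)
      linarith
    · have h1 : MemLp (fun t => -1 * g t + g' t) 2 volume :=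
        (hT.memLp.const_mul (-1)).add hT'.memLp
      exact (MemLp.integrable_mul h1 h1).integrableOn
  have h1 : EqOn (primitive g') (primitive g) J := by
    intro y hy
    refine intervalIntegral.integral_congr_ae ?_
    filter_upwards [hae] with t ht htI
    rw [uIoc_of_le hy.1] at htI
    exact ht ⟨htI.1, htI.2.trans hy.2⟩
  have hx' : -x ∈ J := ⟨by linarith [hx.2], by linarith [hx.1]⟩
  have h2 := primitive_iterate_congr h1 (r - 1) hx
  rw [← Function.iterate_succ_apply, ← Function.iterate_succ_apply,
    show (r - 1).succ = r by omega, hprim r le_rfl, (Even.add_self r).neg_one_pow, one_mul] at h2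
  rw [hf.eq_primitive (by omega) hx, hf.eq_primitive (by omega) hx', h2]

end SymmetryOfExtremals

theorem theorem2 (r k : ℕ) (hk : k = 4 ∨ k = 6) (hr : k < r) :
    -- extremals exist, and every extremal is even on `[-1, 1]`
    (∃ f, SymmetryOfExtremals.IsExtremal r k 2 ⊤ f) ∧
    (∀ f, SymmetryOfExtremals.IsExtremal r k 2 ⊤ f → ∀ x ∈ Icc (-1 : ℝ) 1, f (-x) = f x) ∧
    -- the maxima defining `A_{r,k}` are attained, and `A_{r,k}` has its global maximum at `0`
    (∀ x ∈ Icc (-1 : ℝ) 1,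
      IsGreatest (SymmetryOfExtremals.pointValues r k x) (SymmetryOfExtremals.A r k x)) ∧
    IsMaxOn (SymmetryOfExtremals.A r k) (Icc (-1 : ℝ) 1) 0 ∧
    -- the best constant and its closed forms
    SymmetryOfExtremals.bestConst r k 2 ⊤ = (SymmetryOfExtremals.A r k 0)⁻¹ ∧
    (k = 4 → SymmetryOfExtremals.bestConst r k 2 ⊤ =
      2 ^ (r - 2) * ((r - 3)! : ℝ) / 3 * √((2 * (r : ℝ) - 9) / 2)) ∧
    (k = 6 → SymmetryOfExtremals.bestConst r k 2 ⊤ =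
      2 ^ (r - 2) * ((r - 4)! : ℝ) / 30 * √((2 * (r : ℝ) - 13) / 2)) := by
  open SymmetryOfExtremals in
  have h0 : (0 : ℝ) ∈ J := ⟨by norm_num, by norm_num⟩
  obtain ⟨j, hj⟩ : ∃ j, k = 2 * (j + 1) := by
    rcases hk with h | h
    · exact ⟨1, h⟩
    · exact ⟨2, h⟩
  obtain ⟨m, hm⟩ : ∃ m, r = m + 2 * (j + 1) + 1 := ⟨r - k - 1, by omega⟩
  have hmr : m + 1 ≤ r := by omega
  have hkr : r - (m + 1) = k := by omega
  have hpos : 0 < sqDist m r 0 := hm ▸ sqDist_even_zero_pos m j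
  have hlt : ∀ x, x ≠ 0 → sqDist m r x < sqDist m r 0 := fun x hx => hm ▸ sqDist_lt_sqDist_zero m j hx
  have hmax : ∀ x ∈ J, sqDist m r x ≤ sqDist m r 0 := fun x _ => by
    rcases eq_or_ne x 0 with rfl | hx
    · exact le_rfl
    · exact (hlt x hx).le
  have hadm := admissible_reprPrim hmr h0 hpos
  have hA : ∀ x ∈ J, A r k x = √(sqDist m r x) := fun x hx => hkr ▸ A_eq_sqrt hmr hx
  have hlow : ∀ f, Admissible r 2 f → (√(sqDist m r 0))⁻¹ ≤ ratio r k 2 ⊤ f :=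
    fun f hf => hkr ▸ (hf.le_ratio hmr hpos hmax).1
  have hrat : ratio r k 2 ⊤ (reprPrim m r 0 1) = (√(sqDist m r 0))⁻¹ :=
    le_antisymm (hkr ▸ ratio_reprPrim_le hmr hpos) (hlow _ hadm)
  have hbest : bestConst r k 2 ⊤ = (√(sqDist m r 0))⁻¹ := by
    refine IsLeast.csInf_eq ⟨⟨_, hadm, hrat⟩, ?_⟩
    rintro _ ⟨f, hf, rfl⟩
    exact hlow f hf
  have hval : bestConst r k 2 ⊤ =
      √(2 * (2 * m + 1)) / |legendrePrim m (m + 2 * (j + 1)) 0| := by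
    rw [hbest, hm, sqDist_even_zero, Real.sqrt_div' _ (by positivity), Real.sqrt_sq_eq_abs, inv_div]
  refine ⟨⟨_, hadm, fun f hf => hrat.trans_le (hlow f hf)⟩, fun f hf x hx => ?_, fun x hx => ?_,
    fun x hx => ?_, ?_, fun hk4 => ?_, fun hk6 => ?_⟩
  · have hfr : ratio r k 2 ⊤ f = (√(sqDist m r 0))⁻¹ :=
      le_antisymm ((hf.2 _ hadm).trans hrat.le) (hlow f hf.1)
    rw [← hkr] at hfr
    obtain ⟨y, -, hy0, hy⟩ := (hf.1.le_ratio hmr hpos hmax).2 hfr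
    obtain rfl : y = 0 := by
      by_contra hne
      exact (hlt y hne).ne hy0
    exact hf.1.1.even_of_D_sq_eq hmr ⟨j + 1, by omega⟩ hpos hy hx
  · rw [hA x hx]
    exact hkr ▸ isGreatest_pointValues hmr hx
  · change A r k x ≤ A r k 0
    rw [hA x hx, hA 0 h0]
    exact Real.sqrt_le_sqrt (hmax x hx)
  · rw [hbest, hA 0 h0]
  · obtain rfl : j = 1 := by omega
    have e : (2 * (2 * (m : ℝ) + 1)) = 2 ^ 2 * ((2 * (r : ℝ) - 9) / 2) := by
      rw [hm]; push_cast; ring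
    rw [hval, legendrePrim_even_zero, e, Real.sqrt_mul (by norm_num), Real.sqrt_sq (by norm_num),
      abs_mul, abs_div, abs_pow, abs_neg, abs_one, one_pow, hm,
      show m + 2 * (1 + 1) + 1 - 2 = m + 3 by omega, show m + 2 * (1 + 1) + 1 - 3 = m + 2 by omega,
      show m + (1 + 1) = m + 2 by omega, abs_of_pos (by positivity : (0 : ℝ) < 2 ^ (m + 2) * (m + 2)!)]
    norm_num [Finset.prod_range_succ]
    field_simp
    ring
  · obtain rfl : j = 2 := by omega
    have e : (2 * (2 * (m : ℝ) + 1)) = 2 ^ 2 * ((2 * (r : ℝ) - 13) / 2) := by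
      rw [hm]; push_cast; ring
    rw [hval, legendrePrim_even_zero, e, Real.sqrt_mul (by norm_num), Real.sqrt_sq (by norm_num),
      abs_mul, abs_div, abs_pow, abs_neg, abs_one, one_pow, hm,
      show m + 2 * (2 + 1) + 1 - 2 = m + 5 by omega, show m + 2 * (2 + 1) + 1 - 4 = m + 3 by omega,
      show m + (2 + 1) = m + 3 by omega, abs_of_pos (by positivity : (0 : ℝ) < 2 ^ (m + 3) * (m + 3)!)]
    norm_num [Finset.prod_range_succ]
    field_simp
    ring
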